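/- For $\varepsilon>0$ consider on $\mathbb R^3\times[0,\infty)$ the artificial compressibility system $$\partial_t u+\nabla p=\Delta u-(u\cdot\nabla)u-\tfrac12(\operatorname{div}u)\,u,\qquad \varepsilon\,\partial_t p+\operatorname{div}u=0,$$ with initial data $u(\cdot,0)=u_0\in L^2(\mathbb R^3;\mathbb R^3)$, $p(\cdot,0)=p_0\in L^2(\mathbb R^3)$. A (finite energy) weak solution is a pair $(u,p)$ such that, for every $T>0$, $u\in L^\infty([0,T];L^2(\mathbb R^3))\cap L^2([0,T];\dot H^1(\mathbb R^3))$ and $\sqrt\varepsilon\,p\in L^\infty([0,T];L^2(\mathbb R^3))$; such that both equations and the initial conditions hold in the weak sense, i.e. tested against $C_c^\infty$ functions on $\mathbb R^3\times[0,\infty)$ (which need not vanish at $t=0$); and such that the energy inequality $$\tfrac12\|u(t)\|_{L^2}^2+\tfrac{\varepsilon}{2}\|p(t)\|_{L^2}^2+\int_0^t\|\nabla u(s)\|_{L^2}^2\,ds\le \tfrac12\|u_0\|_{L^2}^2+\tfrac{\varepsilon}{2}\|p_0\|_{L^2}^2$$ holds for almost every $t>0$. Let $Q=\nabla\Delta^{-1}\operatorname{div}$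 and $P=I-Q$ be the Leray projectors of $L^2(\mathbb R^3;\mathbb R^3)$ onto gradient fields and onto divergence-free fields. Let $\varepsilon_n>0$ with $\varepsilon_n\to0$, and let the initial data $u_0^{\varepsilon_n}\in L^2(\mathbb R^3;\mathbb R^3)$, $p_0^{\varepsilon_n}\in L^2(\mathbb R^3)$ satisfy (ID) $u_0^{\varepsilon_n}$ converges strongly in $L^2(\mathbb R^3)$ to some $u_0$, and $\sqrt{\varepsilon_n}\,p_0^{\varepsilon_n}\to0$ strongly in $L^2(\mathbb R^3)$. Then for every $T>0$ there is a constant $C_T$ such that for every $n$, every weak solution $(u^{\varepsilon_n},p^{\varepsilon_n})$ of the system with $\varepsilon=\varepsilon_n$ and initial data $(u_0^{\varepsilon_n},p_0^{\varepsilon_n})$, and every $h\in(0,1)$, $$\|Pu^{\varepsilon_n}(t+h)-Pu^{\varepsilon_n}(t)\|_{L^2([0,T]\times\mathbb R^3)}\le C_T\,h^{1/5}.$$ The constant $C_T$ does not depend on $n$, $h$ or the solution. -/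

import Mathlib

open MeasureTheory Filter Topology Set
open scoped ContDiff ENNReal

namespace ArtificialCompressibility

/-- The space `ℝ³` with its Euclidean norm. -/
abbrev R3 : Type := EuclideanSpace ℝ (Fin 3)

/-- The `j`-th unit vector of `ℝ³`. -/
noncomputable abbrev unitVec (j : Fin 3) : R3 := EuclideanSpace.single j (1 : ℝ)

/-- `L²(ℝ³; ℝ³)`: square integrable vector fields. -/
abbrev VectorL2 : Type := Lp R3 2 (volume : Measure R3)

/-- `L²(ℝ³)`: square integrable scalar functions. -/
abbrev ScalarL2 : Type := Lp ℝ 2 (volume : Measure R3)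

/-! ### The Leray projectors -/

/-- The space of gradients `∇φ` of scalar test functions `φ ∈ C_c^∞(ℝ³)`, inside `L²(ℝ³; ℝ³)`. -/
noncomputable def gradientFields : Submodule ℝ VectorL2 :=
  Submodule.span ℝ {v : VectorL2 | ∃ φ : R3 → ℝ, ContDiff ℝ ∞ φ ∧ HasCompactSupport φ ∧
    (v : R3 → R3) =ᵐ[volume] gradient φ}

/-- The Leray projector `Q = ∇ Δ⁻¹ div` on the space of gradient fields: the orthogonal projection
of `L²(ℝ³; ℝ³)` onto the closed subspace of gradients. -/
noncomputable def lerayQ : VectorL2 →L[ℝ] VectorL2 :=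
  gradientFields.topologicalClosure.starProjection

/-- The Leray projector `P = I - Q` on the space of divergence-free fields. -/
noncomputable def lerayP : VectorL2 →L[ℝ] VectorL2 :=
  ContinuousLinearMap.id ℝ VectorL2 - lerayQ

/-! ### Weak solutions of the artificial compressibility system -/

/-- `w` is the weak partial derivative `∂_j v` of the vector field `v`. -/
def IsWeakPartial (j : Fin 3) (v w : VectorL2) : Prop :=
  ∀ φ : R3 → ℝ, ContDiff ℝ ∞ φ → HasCompactSupport φ →
    ∫ x, (fderiv ℝ φ x (unitVec j)) • v x = - ∫ x, φ x • w x

/-- Time derivative of a function of `(t, x)`. -/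
noncomputable def timeDeriv {F : Type*} [NormedAddCommGroup F] [NormedSpace ℝ F]
    (φ : ℝ × R3 → F) (t : ℝ) (x : R3) : F :=
  fderiv ℝ φ (t, x) (1, 0)

/-- Space derivative `∂_j` of a function of `(t, x)`. -/
noncomputable def spaceDeriv {F : Type*} [NormedAddCommGroup F] [NormedSpace ℝ F]
    (φ : ℝ × R3 → F) (j : Fin 3) (t : ℝ) (x : R3) : F :=
  fderiv ℝ φ (t, x) (0, unitVec j)

/-- `(u, p)` is a finite energy weak solution on `ℝ³ × [0, ∞)`, with data `(u₀, p₀)`, of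
`∂ₜ u + ∇ p = Δ u - (u·∇)u - ½ (div u) u`, `ε ∂ₜ p + div u = 0`, and `D j t` is the weak derivative
`∂_j u(t)`. The test functions are the restrictions to `t ≥ 0` of functions in `C_c^∞(ℝ × ℝ³)`;
they need not vanish at `t = 0`, so that the equations contain the initial conditions. -/
structure IsWeakSolutionWithGradient (ε : ℝ) (u₀ : VectorL2) (p₀ : ScalarL2)
    (u : ℝ → VectorL2) (p : ℝ → ScalarL2) (D : Fin 3 → ℝ → VectorL2) : Prop where
  /-- `u ∈ L^∞([0,T]; L²)` for all `T`. -/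
  velocity_memLp : ∀ T : ℝ, 0 < T → MemLp u ∞ (volume.restrict (Ioc 0 T))
  /-- `√ε p ∈ L^∞([0,T]; L²)` for all `T`. -/
  pressure_memLp : ∀ T : ℝ, 0 < T →
    MemLp (fun t => Real.sqrt ε • p t) ∞ (volume.restrict (Ioc 0 T))
  /-- `∇u ∈ L²([0,T]; L²)` for all `T`. -/
  gradient_memLp : ∀ T : ℝ, 0 < T → ∀ j, MemLp (D j) 2 (volume.restrict (Ioc 0 T))
  isWeakPartial : ∀ᵐ t ∂(volume.restrict (Ioi (0 : ℝ))), ∀ j, IsWeakPartial j (u t) (D j t)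
  /-- The momentum equation with its initial condition. -/
  momentum : ∀ φ : ℝ × R3 → R3, ContDiff ℝ ∞ φ → HasCompactSupport φ →
    ∫ t in Ioi (0 : ℝ), ∫ x,
      (- inner ℝ (u t x) (timeDeriv φ t x)
        - p t x * (∑ j, spaceDeriv φ j t x j)
        + (∑ j, inner ℝ (D j t x) (spaceDeriv φ j t x))
        + inner ℝ (∑ j, u t x j • D j t x) (φ (t, x))
        + (1 / 2) * (∑ j, D j t x j) * inner ℝ (u t x) (φ (t, x)))
      = ∫ x, inner ℝ (u₀ x) (φ (0, x))
  /-- The pressure equation with its initial condition. -/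
  pressure : ∀ φ : ℝ × R3 → ℝ, ContDiff ℝ ∞ φ → HasCompactSupport φ →
    ∫ t in Ioi (0 : ℝ), ∫ x,
      (- (ε * p t x * timeDeriv φ t x) + (∑ j, D j t x j) * φ (t, x))
      = ε * ∫ x, p₀ x * φ (0, x)
  /-- The energy inequality, `|∇u|² = ∑ⱼ |∂ⱼu|²`. -/
  energy : ∀ᵐ t ∂(volume.restrict (Ioi (0 : ℝ))),
    1 / 2 * ‖u t‖ ^ 2 + ε / 2 * ‖p t‖ ^ 2 + ∫ s in Ioc 0 t, ∑ j, ‖D j s‖ ^ 2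
      ≤ 1 / 2 * ‖u₀‖ ^ 2 + ε / 2 * ‖p₀‖ ^ 2

/-- `(u, p)` is a finite energy weak solution of the artificial compressibility system with
parameter `ε` and initial data `(u₀, p₀)`. -/
def IsWeakSolution (ε : ℝ) (u₀ : VectorL2) (p₀ : ScalarL2)
    (u : ℝ → VectorL2) (p : ℝ → ScalarL2) : Prop :=
  ∃ D : Fin 3 → ℝ → VectorL2, IsWeakSolutionWithGradient ε u₀ p₀ u p D

/-- Condition (ID) on the initial data along a sequence of parameters `ε n`: `u₀ n` converges
strongly in `L²` to some `v₀`, and `√(ε n) p₀ n` converges strongly in `L²` to `0`. -/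
def InitialDataCondition (ε : ℕ → ℝ) (u₀ : ℕ → VectorL2) (p₀ : ℕ → ScalarL2) : Prop :=
  (∃ v₀ : VectorL2, Tendsto u₀ atTop (𝓝 v₀)) ∧
    Tendsto (fun n => Real.sqrt (ε n) • p₀ n) atTop (𝓝 0)

end ArtificialCompressibility

namespace ArtificialCompressibility

/-! Fix `t`, put z = u(t+h) - u(t) and w = Pz, and let k be a mollifier of radius δ. Since P is an
orthogonal projection, ‖w‖² = ⟨z, w⟩ = ⟨z, w - k⋆w⟩ + ⟨z, k⋆w⟩.

The first term is at most δ ‖z‖ (‖∇u(t+h)‖ + ‖∇u(t)‖) up to a constant: P commutes with translations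
and is a contraction, so w inherits the translation estimate of u (`norm_translate_sub_le`,
`norm_translate_lerayP_sub_le`).

For the second, the momentum equation is tested with k⋆w. This field is divergence-free, so the
pressure, for which no bound uniform in ε is available, drops out. The viscous term costs ‖∇(k⋆w)‖ ≲
δ⁻¹‖w‖, and the nonlinear term costs ‖k⋆w‖_∞ ≲ δ^(-3/2)‖w‖, each times an integral over [t, t+h] of
‖∇u‖ or ‖u‖‖∇u‖. Integration over t in [0, T] turns these windows into a factor h. With the energy
bounds on u, which (ID) makes uniform in n, the squared norm is ≲ δ + hδ⁻¹ + hδ^(-3/2). The choice δ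
= h^(2/5) gives h^(2/5), and the square root gives h^(1/5).

Two technical points remain. P destroys compact support, so k⋆w is not an admissible test field;
`abs_inner_le_of_forall_test` removes this restriction by cutoffs. The equation holds only in the
sense of distributions in time, so `abs_inner_sub_le_integral` recovers increments at almost every
pair of times t, t+h by testing with smoothed indicators of [t, t+h]. -/

/-! ### Translations in `L²` -/

/-- Translation `v ↦ v(· + y)` on `L²(ℝ³; ℝ³)`. -/
noncomputable def translate (y : R3) : VectorL2 →ₗᵢ[ℝ] VectorL2 :=
  Lp.compMeasurePreservingₗᵢ ℝ (· + y) (measurePreserving_add_right volume y)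

theorem coeFn_translate (y : R3) (v : VectorL2) :
    translate y v =ᵐ[volume] fun x => v (x + y) :=
  Lp.coeFn_compMeasurePreserving v (measurePreserving_add_right volume y)

theorem continuous_translate (v : VectorL2) : Continuous fun y => translate y v := by
  have hc : Continuous fun y : R3 => (⟨fun x => x + y, by fun_prop⟩ : C(R3, R3)) :=
    ContinuousMap.continuous_of_continuous_uncurry _ (by
      simp only [Function.uncurry_def, ContinuousMap.coe_mk]; fun_prop)
  exact Continuous.compMeasurePreservingLp (μ := (volume : Measure R3)) (ν := volume)
    (continuous_const (y := v)) hc (fun y => measurePreserving_add_right volume y) (by simp)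

theorem translate_zero (v : VectorL2) : translate 0 v = v := by
  apply Lp.ext
  filter_upwards [coeFn_translate 0 v] with x hx
  simp [hx]

theorem translate_neg_translate (y : R3) (v : VectorL2) : translate (-y) (translate y v) = v := by
  apply Lp.ext
  have h := (measurePreserving_add_right (volume : Measure R3) (-y)).quasiMeasurePreserving.ae
    (coeFn_translate y v)
  filter_upwards [coeFn_translate (-y) (translate y v), h] with x hx h1
  rw [hx, h1]
  simp

theorem translate_translate_neg (y : R3) (v : VectorL2) : translate y (translate (-y) v) = v := by
  simpa using translate_neg_translate (-y) v

theorem inner_translate (y : R3) (v w : VectorL2) :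
    inner ℝ (translate y v) w = inner ℝ v (translate (-y) w) := by
  rw [← (translate y).inner_map_map v (translate (-y) w), translate_translate_neg]

/-! ### The Leray projector commutes with translations -/

theorem gradient_comp_add_right (φ : R3 → ℝ) (y x : R3) :
    gradient (fun z => φ (z + y)) x = gradient φ (x + y) := by
  simp only [gradient, fderiv_comp_add_right]

theorem translate_mem_gradientFields (y : R3) {v : VectorL2} (hv : v ∈ gradientFields) :
    translate y v ∈ gradientFields := by
  have h : gradientFields ≤ gradientFields.comap (translate y).toLinearMap := by
    refine Submodule.span_le.2 ?_
    rintro v ⟨φ, hφ, hc, hv⟩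
    refine Submodule.subset_span ⟨fun x => φ (x + y), by fun_prop,
      hc.comp_homeomorph (Homeomorph.addRight y), ?_⟩
    have h := (measurePreserving_add_right (volume : Measure R3) y).quasiMeasurePreserving.ae hv
    filter_upwards [coeFn_translate y v, h] with x hx h1
    simp only [LinearIsometry.coe_toLinearMap]
    rw [hx, h1, gradient_comp_add_right]
  exact h hv

theorem translate_mem_closure_gradientFields (y : R3) {v : VectorL2}
    (hv : v ∈ gradientFields.topologicalClosure) :
    translate y v ∈ gradientFields.topologicalClosure :=
  map_mem_closure (translate y).continuous hv fun _ h => translate_mem_gradientFields y h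

/-- The closed space of gradients is invariant under all translations. Hence the translate of Qv is
a gradient, and the translate of v - Qv is still orthogonal to gradients because the adjoint of a
translation is the opposite translation. These two properties characterise the projection. -/
theorem lerayQ_translate (y : R3) (v : VectorL2) :
    lerayQ (translate y v) = translate y (lerayQ v) := by
  refine Submodule.eq_starProjection_of_mem_of_inner_eq_zero
    (translate_mem_closure_gradientFields y (Submodule.starProjection_apply_mem _ _)) ?_
  intro w hw
  rw [← map_sub, inner_translate]
  exact Submodule.starProjection_inner_eq_zero _ _ (translate_mem_closure_gradientFields (-y) hw)

theorem lerayP_translate (y : R3) (v : VectorL2) :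
    lerayP (translate y v) = translate y (lerayP v) := by
  simp [lerayP, lerayQ_translate]

theorem inner_lerayP_of_mem (v : VectorL2) {w : VectorL2} (hw : w ∈ gradientFields) :
    inner ℝ (lerayP v) w = 0 :=
  Submodule.starProjection_inner_eq_zero _ _ (Submodule.le_topologicalClosure _ hw)

theorem lerayP_eq_starProjection (v : VectorL2) :
    lerayP v = gradientFields.topologicalClosureᗮ.starProjection v := by
  rw [Submodule.starProjection_orthogonal']
  rfl

theorem norm_lerayP_le (v : VectorL2) : ‖lerayP v‖ ≤ ‖v‖ := by
  rw [lerayP_eq_starProjection]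
  exact Submodule.norm_starProjection_apply_le _ _

theorem norm_lerayP_sq (v : VectorL2) : ‖lerayP v‖ ^ 2 = inner ℝ v (lerayP v) := by
  rw [lerayP_eq_starProjection, ← real_inner_self_eq_norm_sq,
    Submodule.inner_starProjection_left_eq_right, ← Submodule.inner_starProjection_left_eq_right,
    Submodule.inner_starProjection_left_eq_right,
    Submodule.starProjection_eq_self_iff.2 (Submodule.starProjection_apply_mem _ _)]

/-! ### Pairing with scalar test functions -/

theorem locallyIntegrable_coe {F : Type*} [NormedAddCommGroup F] (v : Lp F 2 (volume : Measure R3)) :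
    LocallyIntegrable v volume :=
  (Lp.memLp v).locallyIntegrable (by norm_num)

theorem integrable_smul_coe {k : R3 → ℝ} (hk : Continuous k) (hc : HasCompactSupport k)
    (v : VectorL2) : Integrable (fun x => k x • v x) volume :=
  (locallyIntegrable_coe v).integrable_smul_left_of_hasCompactSupport hk hc

/-- The pairing `v ↦ ∫ k v` with a continuous compactly supported function. -/
noncomputable def pairing (k : R3 → ℝ) (hk : Continuous k) (hc : HasCompactSupport k) :
    VectorL2 →L[ℝ] R3 :=
  LinearMap.mkContinuous
    { toFun := fun v => ∫ x, k x • v x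
      map_add' := fun v w => by
        rw [← integral_add (integrable_smul_coe hk hc v) (integrable_smul_coe hk hc w)]
        refine integral_congr_ae ?_
        filter_upwards [Lp.coeFn_add v w] with x hx
        rw [hx, Pi.add_apply, smul_add]
      map_smul' := fun c v => by
        rw [RingHom.id_apply, ← integral_smul]
        refine integral_congr_ae ?_
        filter_upwards [Lp.coeFn_smul c v] with x hx
        rw [hx, Pi.smul_apply, smul_comm] }
    ((∫ x, ‖k x‖ ^ (2 : ℝ)) ^ (1 / 2 : ℝ)) fun v => by
      refine (norm_integral_le_integral_norm _).trans ?_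
      simp only [norm_smul]
      have h := integral_mul_norm_le_Lp_mul_Lq (μ := volume) (f := k)
        (g := fun x => ‖v x‖) Real.HolderConjugate.two_two
        (by simpa using hk.memLp_of_hasCompactSupport (p := 2) hc)
        (by simpa using (Lp.memLp v).norm)
      simp only [norm_norm] at h
      refine h.trans (le_of_eq ?_)
      congr 1
      rw [Lp.norm_def, eLpNorm_eq_lintegral_rpow_enorm_toReal (by simp) (by simp),
        integral_eq_lintegral_of_nonneg_ae (Eventually.of_forall fun x => by positivity)
          ((Lp.aestronglyMeasurable v).norm.aemeasurable.pow_const _).aestronglyMeasurable,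
        ENNReal.toReal_rpow]
      simp [← ofReal_norm, ENNReal.ofReal_pow]

theorem pairing_apply {k : R3 → ℝ} (hk : Continuous k) (hc : HasCompactSupport k) (v : VectorL2) :
    pairing k hk hc v = ∫ x, k x • v x := rfl

theorem norm_pairing_apply_le {k : R3 → ℝ} (hk : Continuous k) (hc : HasCompactSupport k)
    (v : VectorL2) :
    ‖pairing k hk hc v‖ ≤ (∫ x, ‖k x‖ ^ (2 : ℝ)) ^ (1 / 2 : ℝ) * ‖v‖ :=
  LinearMap.mkContinuous_norm_le _ (by positivity) _ |> ContinuousLinearMap.le_of_opNorm_le _ <| v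

/-- Reduces identities in `L²` to identities in ℝ³, where derivatives in a translation parameter can
be computed classically. -/
theorem ext_pairing {v w : VectorL2}
    (h : ∀ (k : R3 → ℝ) (hk : ContDiff ℝ ∞ k) (hc : HasCompactSupport k),
      pairing k hk.continuous hc v = pairing k hk.continuous hc w) : v = w :=
  Lp.ext (ae_eq_of_integral_contDiff_smul_eq (locallyIntegrable_coe v) (locallyIntegrable_coe w) h)

/-! ### Mollification -/

/-- The mollification `k ⋆ v`. -/
noncomputable def mollify (k : R3 → ℝ) (v : R3 → R3) : R3 → R3 :=
  convolution k v (ContinuousLinearMap.lsmul ℝ ℝ) volume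

theorem mollify_apply (k : R3 → ℝ) (v : R3 → R3) (x : R3) :
    mollify k v x = ∫ t, k t • v (x - t) := rfl

theorem mollify_apply_swap (k : R3 → ℝ) (v : R3 → R3) (x : R3) :
    mollify k v x = ∫ t, k (x - t) • v t := by
  rw [mollify_apply, ← integral_sub_left_eq_self _ volume x]
  simp

theorem contDiff_mollify {k : R3 → ℝ} (hk : ContDiff ℝ ∞ k) (hc : HasCompactSupport k)
    (v : VectorL2) : ContDiff ℝ ∞ (mollify k v) :=
  hc.contDiff_convolution_left _ hk (locallyIntegrable_coe v)

theorem contDiff_fderiv_apply {F : Type*} [NormedAddCommGroup F] [NormedSpace ℝ F] {k : R3 → F}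
    (hk : ContDiff ℝ ∞ k) (a : R3) : ContDiff ℝ ∞ fun x => fderiv ℝ k x a :=
  (hk.fderiv_right (m := ∞) (by simp)).clm_apply contDiff_const

theorem hasCompactSupport_fderiv_apply {F : Type*} [NormedAddCommGroup F] [NormedSpace ℝ F]
    {k : R3 → F} (hc : HasCompactSupport k) (a : R3) :
    HasCompactSupport fun x => fderiv ℝ k x a :=
  hc.fderiv_apply (𝕜 := ℝ) a

theorem fderiv_mollify_apply {k : R3 → ℝ} (hk : ContDiff ℝ ∞ k) (hc : HasCompactSupport k)
    (v : VectorL2) (x a : R3) :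
    fderiv ℝ (mollify k v) x a = mollify (fun t => fderiv ℝ k t a) v x := by
  have h1 : ContDiff ℝ 1 k := hk.of_le (by norm_cast)
  have h := hc.hasFDerivAt_convolution_left (𝕜 := ℝ) (ContinuousLinearMap.lsmul ℝ ℝ) h1
    (locallyIntegrable_coe v) x
  have h' : HasFDerivAt (mollify k v) _ x := h
  rw [h'.fderiv]
  have hi : Integrable (fun t => ((ContinuousLinearMap.lsmul ℝ ℝ).precompL R3 (fderiv ℝ k t))
      (v (x - t))) volume :=
    (hc.fderiv (𝕜 := ℝ)).convolutionExists_left _ (h1.continuous_fderiv one_ne_zero)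
      (locallyIntegrable_coe v) x
  rw [convolution, ContinuousLinearMap.integral_apply hi]
  rfl

/-- Substitution x ↦ -x. For smooth k it shows that z ↦ v(· + z), though only continuous into `L²`,
becomes smooth in z after pairing with k. -/
theorem pairing_translate {k : R3 → ℝ} (hk : Continuous k) (hc : HasCompactSupport k)
    (v : VectorL2) (z : R3) :
    pairing k hk hc (translate z v) = mollify (fun x => k (-x)) v z := by
  rw [pairing_apply, mollify_apply, ← integral_neg_eq_self]
  refine integral_congr_ae ?_
  have h := (Measure.measurePreserving_neg (volume : Measure R3)).quasiMeasurePreserving.ae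
    (coeFn_translate z v)
  filter_upwards [h] with x hx
  rw [hx, sub_eq_neg_add]

theorem mollify_fderiv_of_isWeakPartial {k : R3 → ℝ} (hk : ContDiff ℝ ∞ k)
    (hc : HasCompactSupport k) {j : Fin 3} {v w : VectorL2} (h : IsWeakPartial j v w) (z : R3) :
    mollify (fun t => fderiv ℝ k t (unitVec j)) v z = mollify k w z := by
  have h1 := h (fun x => k (z - x)) (by fun_prop)
    (hc.comp_homeomorph (Homeomorph.subLeft z))
  rw [mollify_apply_swap, mollify_apply_swap, ← neg_eq_iff_eq_neg.2 h1, ← integral_neg]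
  refine integral_congr_ae (Eventually.of_forall fun x => ?_)
  have h2 : HasFDerivAt (fun x => k (z - x)) (-fderiv ℝ k (z - x)) x := by
    refine (((hk.differentiable (by simp) (z - x)).hasFDerivAt).comp x
      ((hasFDerivAt_id x).const_sub z)).congr_fderiv ?_
    ext
    simp
  simp only [h2.fderiv]
  simp

/-- For `v ∈ L²` with weak gradient `D ∈ L²`, `‖v(· + y) - v‖ ≤ |y| ∑ ‖D j‖`. -/
theorem norm_translate_sub_le {v : VectorL2} {D : Fin 3 → VectorL2}
    (h : ∀ j, IsWeakPartial j v (D j)) (y : R3) :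
    ‖translate y v - v‖ ≤ ‖y‖ * ∑ j, ‖D j‖ := by
  have hcont : Continuous fun s : ℝ => ∑ j, y j • translate (s • y) (D j) := by
    refine continuous_finsetSum _ fun j _ => ?_
    exact ((continuous_translate (D j)).comp (f := fun s : ℝ => s • y) (by fun_prop)).const_smul
      (y j)
  -- The fundamental theorem of calculus along s ↦ v(· + sy), checked against test functions, where
  -- the path is differentiable and weak derivatives suffice.
  have key : translate y v - v = ∫ s in (0 : ℝ)..1, ∑ j, y j • translate (s • y) (D j) := by
    refine ext_pairing fun k hk hc => ?_
    rw [← ContinuousLinearMap.intervalIntegral_comp_comm _ (hcont.intervalIntegrable _ _)]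
    have hk' : ContDiff ℝ ∞ fun x => k (-x) := by fun_prop
    have hc' : HasCompactSupport fun x => k (-x) := hc.comp_homeomorph (Homeomorph.neg R3)
    have hd : ∀ s : ℝ, HasDerivAt (fun s : ℝ => pairing k hk.continuous hc (translate (s • y) v))
        (pairing k hk.continuous hc (∑ j, y j • translate (s • y) (D j))) s := by
      intro s
      simp only [pairing_translate, map_sum, map_smul]
      have h1 : HasFDerivAt (mollify (fun x => k (-x)) v)
          (fderiv ℝ (mollify (fun x => k (-x)) v) (s • y)) (s • y) :=
        ((contDiff_mollify hk' hc' v).differentiable (by simp) _).hasFDerivAt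
      have h2 : HasDerivAt (fun s : ℝ => s • y) y s := by
        simpa using (hasDerivAt_id s).smul_const y
      refine (h1.comp_hasDerivAt s h2).congr_deriv ?_
      have h3 := congrArg (fderiv ℝ (mollify (fun x => k (-x)) v) (s • y))
        ((EuclideanSpace.basisFun (Fin 3) ℝ).sum_repr y)
      rw [← h3]
      simp only [map_sum, map_smul, EuclideanSpace.basisFun_repr, EuclideanSpace.basisFun_apply]
      refine Finset.sum_congr rfl fun j _ => ?_
      rw [← mollify_fderiv_of_isWeakPartial hk' hc' (h j), ← fderiv_mollify_apply hk' hc']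
    rw [intervalIntegral.integral_eq_sub_of_hasDerivAt (fun s _ => hd s)
      (((pairing k hk.continuous hc).continuous.comp hcont).intervalIntegrable _ _)]
    simp [translate_zero]
  rw [key]
  refine (intervalIntegral.norm_integral_le_of_norm_le_const (C := ‖y‖ * ∑ j, ‖D j‖)
    fun s _ => ?_).trans (by simp)
  refine (norm_sum_le _ _).trans ?_
  rw [Finset.mul_sum]
  refine Finset.sum_le_sum fun j _ => ?_
  rw [norm_smul, LinearIsometry.norm_map]
  gcongr
  exact PiLp.norm_apply_le y j

/-- The mollification `k ⋆ v` as an element of `L²`. -/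
noncomputable def mollifyL2 (k : R3 → ℝ) (v : VectorL2) : VectorL2 :=
  ∫ y, k y • translate (-y) v

theorem integrable_smul_translate {k : R3 → ℝ} (hk : Continuous k) (hc : HasCompactSupport k)
    (v : VectorL2) : Integrable (fun y => k y • translate (-y) v) volume :=
  (hk.smul ((continuous_translate v).comp continuous_neg)).integrable_of_hasCompactSupport
    hc.smul_right

/-- Young's inequality: a Bochner integral of translates, all of the same norm. Applied to ∂ⱼk it
yields the factor δ⁻¹. -/
theorem norm_mollifyL2_le (k : R3 → ℝ) (v : VectorL2) : ‖mollifyL2 k v‖ ≤ (∫ y, ‖k y‖) * ‖v‖ := by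
  refine (norm_integral_le_integral_norm _).trans (le_of_eq ?_)
  simp only [norm_smul, LinearIsometry.norm_map]
  rw [integral_mul_const]

theorem integral_smul_mollify {g k : R3 → ℝ} (hg : Continuous g) (hgc : HasCompactSupport g)
    (hk : Continuous k) (hc : HasCompactSupport k) (v : VectorL2) :
    ∫ x, g x • mollify k v x = ∫ t, k t • ∫ x, g x • v (x - t) := by
  -- Only the values of v on supp g - supp k enter. Truncation to this compact set makes v
  -- integrable, as Fubini requires.
  have hK : IsCompact ((fun p : R3 × R3 => p.1 - p.2) '' (tsupport g ×ˢ tsupport k)) :=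
    (hgc.prod hc).image (by fun_prop)
  set K := (fun p : R3 × R3 => p.1 - p.2) '' (tsupport g ×ˢ tsupport k)
  have hv : Integrable (K.indicator v) volume :=
    (integrable_indicator_iff hK.measurableSet).2
      ((locallyIntegrable_coe v).integrableOn_isCompact hK)
  have h1 : Integrable (fun p : R3 × R3 => g p.1 • k p.2 • K.indicator v (p.1 - p.2))
      (volume.prod volume) := by
    obtain ⟨C, hC⟩ := hg.bounded_above_of_compact_support hgc
    exact ((hk.integrable_of_hasCompactSupport hc).convolution_integrand
      (ContinuousLinearMap.lsmul ℝ ℝ) hv).bdd_smul C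
      (hg.comp continuous_fst).aestronglyMeasurable (Eventually.of_forall fun p => hC p.1)
  have h2 : ∀ x t, g x • k t • K.indicator v (x - t) = g x • k t • v (x - t) := by
    intro x t
    by_cases hx : x ∈ tsupport g
    · by_cases ht : t ∈ tsupport k
      · rw [indicator_of_mem (show x - t ∈ K from ⟨(x, t), ⟨hx, ht⟩, rfl⟩)]
      · simp [image_eq_zero_of_notMem_tsupport ht]
    · simp [image_eq_zero_of_notMem_tsupport hx]
  simp only [mollify_apply, ← integral_smul]
  simp only [h2] at h1
  rw [integral_integral_swap h1]
  simp only [smul_comm (g _)]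

/-- Links the two forms of k⋆v: the Bochner integral carries the `L²` bounds, the pointwise
convolution carries smoothness, derivatives and sup bounds. -/
theorem coeFn_mollifyL2 {k : R3 → ℝ} (hk : ContDiff ℝ ∞ k) (hc : HasCompactSupport k)
    (v : VectorL2) : mollifyL2 k v =ᵐ[volume] mollify k v := by
  refine ae_eq_of_integral_contDiff_smul_eq (locallyIntegrable_coe _)
    (contDiff_mollify hk hc v).continuous.locallyIntegrable fun g hg hgc => ?_
  rw [← pairing_apply hg.continuous hgc, mollifyL2,
    ← ContinuousLinearMap.integral_comp_comm _ (integrable_smul_translate hk.continuous hc v),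
    integral_smul_mollify hg.continuous hgc hk.continuous hc]
  refine integral_congr_ae (Eventually.of_forall fun y => ?_)
  simp only [map_smul, pairing_apply]
  congr 1
  refine integral_congr_ae ?_
  filter_upwards [coeFn_translate (-y) v] with x hx
  rw [hx, sub_eq_add_neg]

/-- Cauchy–Schwarz, the value at x being the pairing of the reflected kernel with a translate of v.
The `L²` norm of k is the source of δ^(-3/2). -/
theorem norm_mollify_le {k : R3 → ℝ} (hk : Continuous k) (hc : HasCompactSupport k)
    (v : VectorL2) (x : R3) :
    ‖mollify k v x‖ ≤ (∫ y, ‖k y‖ ^ (2 : ℝ)) ^ (1 / 2 : ℝ) * ‖v‖ := by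
  have hk' : Continuous fun x => k (-x) := by fun_prop
  have hc' : HasCompactSupport fun x => k (-x) := hc.comp_homeomorph (Homeomorph.neg R3)
  have h := norm_pairing_apply_le hk' hc' (translate x v)
  rw [pairing_translate, LinearIsometry.norm_map,
    integral_neg_eq_self (fun x => ‖k x‖ ^ (2 : ℝ)) volume] at h
  simpa using h

/-- As k has mass one, v - k⋆v is the k-average of v - v(· - y), and only |y| ≤ δ contributes. -/
theorem norm_sub_mollifyL2_le {k : R3 → ℝ} (hk : Continuous k) (hc : HasCompactSupport k)
    (hk0 : ∀ y, 0 ≤ k y) (hk1 : ∫ y, k y = 1) {δ S : ℝ} (hS : 0 ≤ S)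
    (hδ : ∀ y, δ < ‖y‖ → k y = 0)
    {v : VectorL2} (hv : ∀ y, ‖translate y v - v‖ ≤ ‖y‖ * S) :
    ‖v - mollifyL2 k v‖ ≤ δ * S := by
  have hi := hk.integrable_of_hasCompactSupport (μ := volume) hc
  have h1 : v - mollifyL2 k v = ∫ y, k y • (v - translate (-y) v) := by
    simp only [smul_sub]
    rw [integral_sub (hi.smul_const v) (integrable_smul_translate hk hc v), integral_smul_const,
      hk1, one_smul, mollifyL2]
  rw [h1]
  have h2 : ∫ y, k y * (δ * S) = δ * S := by rw [integral_mul_const, hk1, one_mul]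
  rw [← h2]
  refine norm_integral_le_of_norm_le (hi.mul_const _) (Eventually.of_forall fun y => ?_)
  rw [norm_smul, Real.norm_of_nonneg (hk0 y)]
  rcases lt_or_ge δ ‖y‖ with h | h
  · simp [hδ y h]
  · refine mul_le_mul_of_nonneg_left ?_ (hk0 y)
    rw [norm_sub_rev]
    refine (hv (-y)).trans ?_
    rw [norm_neg]
    gcongr

theorem gradient_eq_sum (φ : R3 → ℝ) (x w : R3) :
    inner ℝ w (gradient φ x) = ∑ j, fderiv ℝ φ x (unitVec j) * w j := by
  have h3 := congrArg (fderiv ℝ φ x) ((EuclideanSpace.basisFun (Fin 3) ℝ).sum_repr w)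
  rw [gradient, real_inner_comm, InnerProductSpace.toDual_symm_apply, ← h3]
  simp [mul_comm]

/-- Mollifications of divergence-free fields are divergence-free. -/
theorem sum_mollify_fderiv_eq_zero {k : R3 → ℝ} (hk : ContDiff ℝ ∞ k) (hc : HasCompactSupport k)
    {w : VectorL2} (hw : ∀ g ∈ gradientFields, inner ℝ w g = 0) (x : R3) :
    ∑ j, mollify (fun t => fderiv ℝ k t (unitVec j)) w x j = 0 := by
  -- Up to sign, the divergence of k⋆w at x is the pairing of w with the gradient of this test
  -- function.
  set φ : R3 → ℝ := fun t => k (x - t)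
  have hφ : ContDiff ℝ ∞ φ := by fun_prop
  have hφc : HasCompactSupport φ := hc.comp_homeomorph (Homeomorph.subLeft x)
  have hd : ∀ t a, fderiv ℝ φ t a = - fderiv ℝ k (x - t) a := by
    intro t a
    have h2 : HasFDerivAt φ (-fderiv ℝ k (x - t)) t := by
      refine (((hk.differentiable (by simp) (x - t)).hasFDerivAt).comp t
        ((hasFDerivAt_id t).const_sub x)).congr_fderiv ?_
      ext
      simp
    rw [h2.fderiv]
    rfl
  have hgc : Continuous (gradient φ) :=
    (InnerProductSpace.toDual ℝ R3).symm.continuous.comp (hφ.continuous_fderiv (by simp))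
  have hgs : HasCompactSupport (gradient φ) :=
    (hφc.fderiv (𝕜 := ℝ)).comp_left (map_zero (InnerProductSpace.toDual ℝ R3).symm)
  have hm : MemLp (gradient φ) 2 volume := hgc.memLp_of_hasCompactSupport hgs
  have h0 := hw (hm.toLp) (Submodule.subset_span ⟨φ, hφ, hφc, hm.coeFn_toLp⟩)
  rw [L2.inner_def] at h0
  have hi : ∀ j, Integrable (fun t => fderiv ℝ k (x - t) (unitVec j) • w t) volume := fun j =>
    integrable_smul_coe
      ((contDiff_fderiv_apply hk (unitVec j)).continuous.comp (continuous_const.sub continuous_id))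
      ((hasCompactSupport_fderiv_apply hc (unitVec j)).comp_homeomorph (Homeomorph.subLeft x)) w
  have h1 : ∀ j, mollify (fun t => fderiv ℝ k t (unitVec j)) w x j
      = ∫ t, fderiv ℝ k (x - t) (unitVec j) * w t j := by
    intro j
    rw [mollify_apply_swap]
    have := (EuclideanSpace.proj (𝕜 := ℝ) j : R3 →L[ℝ] ℝ).integral_comp_comm (hi j)
    simpa using this.symm
  have hi' : ∀ j, Integrable (fun t => fderiv ℝ k (x - t) (unitVec j) * w t j) volume := fun j => by
    simpa using (EuclideanSpace.proj (𝕜 := ℝ) j : R3 →L[ℝ] ℝ).integrable_comp (hi j)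
  simp only [h1]
  rw [← integral_finsetSum _ fun j _ => hi' j, ← neg_eq_zero, ← integral_neg, ← h0]
  refine integral_congr_ae ?_
  filter_upwards [hm.coeFn_toLp] with t ht
  rw [ht, gradient_eq_sum]
  simp [hd]

/-! ### Removing the compact support of the test function -/

theorem exists_cutoff : ∃ (C : ℝ) (χ : ℕ → R3 → ℝ), 0 ≤ C ∧ (∀ n, ContDiff ℝ ∞ (χ n)) ∧
    (∀ n, HasCompactSupport (χ n)) ∧ (∀ n x, |χ n x| ≤ 1) ∧
    (∀ n x, ‖fderiv ℝ (χ n) x‖ ≤ C / (n + 1)) ∧ ∀ x, Tendsto (fun n => χ n x) atTop (𝓝 1) := by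
  let b : ContDiffBump (0 : R3) := ⟨1, 2, by norm_num, by norm_num⟩
  have hb : ContDiff ℝ ∞ b := b.contDiff
  obtain ⟨C, hC⟩ := (hb.continuous_fderiv (by simp)).bounded_above_of_compact_support
    (b.hasCompactSupport.fderiv (𝕜 := ℝ))
  have hC0 : 0 ≤ C := (norm_nonneg _).trans (hC 0)
  refine ⟨C, fun n x => b (((n : ℝ) + 1)⁻¹ • x), hC0, fun n => by fun_prop, fun n => ?_,
    fun n x => ?_, fun n x => ?_, fun x => ?_⟩
  · exact b.hasCompactSupport.comp_homeomorph
      (Homeomorph.smulOfNeZero ((n : ℝ) + 1)⁻¹ (by positivity))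
  · rw [abs_of_nonneg b.nonneg]
    exact b.le_one
  · rw [fderiv_comp_smul (f := b) , norm_smul, Real.norm_of_nonneg (by positivity), div_eq_inv_mul]
    gcongr
    exact hC _
  · refine tendsto_const_nhds.congr' ?_
    obtain ⟨N, hN⟩ := exists_nat_ge ‖x‖
    filter_upwards [eventually_ge_atTop N] with n hn
    refine (b.one_of_mem_closedBall ?_).symm
    have h1 : ‖x‖ ≤ n := hN.trans (by exact_mod_cast hn)
    rw [mem_closedBall_zero_iff, norm_smul, Real.norm_of_nonneg (by positivity), inv_mul_le_iff₀ (by positivity)]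
    change _ ≤ ((n : ℝ) + 1) * 1
    linarith

/-- A bound for the pairing with test functions extends to divergence-free smooth functions in
`L² ∩ L^∞` with gradient in `L²`. -/
theorem abs_inner_le_of_forall_test {z Φ : VectorL2} {a b c : ℝ} {φ : R3 → R3}
    (hz : ∀ (ψ : R3 → R3) (M G H : ℝ), ContDiff ℝ ∞ ψ → HasCompactSupport ψ → (∀ x, ‖ψ x‖ ≤ M) →
      0 ≤ G → 0 ≤ H →
      (∀ j, eLpNorm (fun x => fderiv ℝ ψ x (unitVec j)) 2 volume ≤ ENNReal.ofReal G) →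
      eLpNorm (fun x => ∑ j, fderiv ℝ ψ x (unitVec j) j) 2 volume ≤ ENNReal.ofReal H →
      |∫ x, inner ℝ (z x) (ψ x)| ≤ a * H + b * G + c * M)
    (hφ : ContDiff ℝ ∞ φ) (hΦ : Φ =ᵐ[volume] φ) {M G : ℝ} (hM : ∀ x, ‖φ x‖ ≤ M) (hG0 : 0 ≤ G)
    (hG : ∀ j, eLpNorm (fun x => fderiv ℝ φ x (unitVec j)) 2 volume ≤ ENNReal.ofReal G)
    (hdiv : ∀ x, ∑ j, fderiv ℝ φ x (unitVec j) j = 0) :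
    |inner ℝ z Φ| ≤ b * G + c * M := by
  obtain ⟨C, χ, hC, hχ, hχc, hχ1, hχd, hχt⟩ := exists_cutoff
  have hφL : eLpNorm φ 2 volume = ENNReal.ofReal ‖Φ‖ := by
    rw [← eLpNorm_congr_ae hΦ, Lp.norm_def, ENNReal.ofReal_toReal (Lp.eLpNorm_ne_top Φ)]
  have hd : ∀ n x j, fderiv ℝ (fun x => χ n x • φ x) x (unitVec j)
      = χ n x • fderiv ℝ φ x (unitVec j) + fderiv ℝ (χ n) x (unitVec j) • φ x := by
    intro n x j
    rw [fderiv_fun_smul ((hχ n).differentiable (by simp) x) (hφ.differentiable (by simp) x)]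
    simp
  have hχj : ∀ n x j, |fderiv ℝ (χ n) x (unitVec j)| ≤ C / (n + 1) := fun n x j => by
    simpa using ((fderiv ℝ (χ n) x).le_opNorm (unitVec j)).trans
      (mul_le_mul_of_nonneg_right (hχd n x) (norm_nonneg _))
  have hlim : Tendsto (fun n => |∫ x, inner ℝ (z x) (χ n x • φ x)|) atTop (𝓝 |inner ℝ z Φ|) := by
    refine Tendsto.abs ?_
    have h1 : inner ℝ z Φ = ∫ x, inner ℝ (z x) (φ x) := by
      rw [L2.inner_def]
      refine integral_congr_ae ?_
      filter_upwards [hΦ] with x hx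
      rw [hx]
    rw [h1]
    have hmΦ : MemLp φ 2 volume := (memLp_congr_ae hΦ).1 (Lp.memLp Φ)
    refine tendsto_integral_of_dominated_convergence (fun x => ‖z x‖ * ‖φ x‖) (fun n => ?_)
      ((Lp.memLp z).norm.integrable_mul hmΦ.norm) (fun n => ?_) ?_
    · exact (Lp.aestronglyMeasurable z).inner
        ((hχ n).continuous.smul hφ.continuous).aestronglyMeasurable
    · refine Eventually.of_forall fun x => (norm_inner_le_norm _ _).trans ?_
      rw [norm_smul]
      gcongr
      exact mul_le_of_le_one_left (norm_nonneg _) (hχ1 n x)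
    · refine Eventually.of_forall fun x => ?_
      simpa using tendsto_const_nhds.inner ((hχt x).smul_const (φ x))
  -- As div φ = 0, the divergence of χφ is ∇χ·φ, of `L²` size at most 3C/(n+1)·‖Φ‖ (one summand per
  -- coordinate). However large the pressure coefficient `a` is, its term vanishes as n → ∞.
  have hbound : ∀ n : ℕ, |∫ x, inner ℝ (z x) (χ n x • φ x)|
      ≤ a * (3 * (C / (n + 1)) * ‖Φ‖) + b * (G + C / (n + 1) * ‖Φ‖) + c * M := by
    intro n
    have hCn : 0 ≤ C / ((n : ℝ) + 1) := by positivity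
    refine hz _ _ _ _ ((hχ n).smul hφ) (hχc n).smul_right (fun x => ?_) (by positivity)
      (by positivity) (fun j => ?_) ?_
    · rw [norm_smul]
      exact (mul_le_of_le_one_left (norm_nonneg _) (hχ1 n x)).trans (hM x)
    · have h1 : eLpNorm (fun x => fderiv ℝ (fun x => χ n x • φ x) x (unitVec j)) 2 volume
          ≤ eLpNorm (fun x => χ n x • fderiv ℝ φ x (unitVec j)) 2 volume
            + eLpNorm (fun x => fderiv ℝ (χ n) x (unitVec j) • φ x) 2 volume := by
        simp only [hd]
        refine eLpNorm_add_le ?_ ?_ (by norm_num)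
        · exact ((hχ n).continuous.smul (contDiff_fderiv_apply hφ _).continuous).aestronglyMeasurable
        · exact ((contDiff_fderiv_apply (hχ n) _).continuous.smul
            hφ.continuous).aestronglyMeasurable
      refine h1.trans ?_
      rw [ENNReal.ofReal_add hG0 (by positivity)]
      refine add_le_add ((eLpNorm_mono fun x => ?_).trans (hG j)) ?_
      · rw [norm_smul]
        exact mul_le_of_le_one_left (norm_nonneg _) (hχ1 n x)
      · rw [ENNReal.ofReal_mul hCn, ← hφL]
        refine eLpNorm_le_mul_eLpNorm_of_ae_le_mul (Eventually.of_forall fun x => ?_) 2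
        rw [norm_smul]
        gcongr
        exact hχj n x j
    · rw [ENNReal.ofReal_mul (by positivity), ← hφL]
      refine eLpNorm_le_mul_eLpNorm_of_ae_le_mul (Eventually.of_forall fun x => ?_) 2
      have h2 : ∑ j, fderiv ℝ (fun x => χ n x • φ x) x (unitVec j) j
          = ∑ j, fderiv ℝ (χ n) x (unitVec j) * φ x j := by
        simp only [hd, PiLp.add_apply, PiLp.smul_apply, smul_eq_mul, Finset.sum_add_distrib,
          ← Finset.mul_sum, hdiv]
        simp
      rw [h2]
      refine (norm_sum_le _ _).trans ?_
      refine (Finset.sum_le_card_nsmul _ _ (C / (n + 1) * ‖φ x‖) fun j _ => ?_).trans ?_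
      · rw [norm_mul]
        exact mul_le_mul (hχj n x j) (PiLp.norm_apply_le _ _) (norm_nonneg _) hCn
      · simp [mul_assoc]
  refine le_of_tendsto_of_tendsto hlim (b := atTop) ?_ (Eventually.of_forall hbound)
  have h0 : Tendsto (fun n : ℕ => C / ((n : ℝ) + 1)) atTop (𝓝 0) := by
    simpa [div_eq_mul_inv] using tendsto_one_div_add_atTop_nhds_zero_nat.const_mul C
  have := (((h0.const_mul 3).mul_const ‖Φ‖).const_mul a).add
    (((h0.mul_const ‖Φ‖).const_add G).const_mul b) |>.add_const (c * M)
  simpa using this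

/-! ### From the weak formulation in time to increments -/

/-- A sequence of bump functions on the line with radii tending to zero. -/
noncomputable def timeBump (n : ℕ) : ContDiffBump (0 : ℝ) :=
  ⟨1 / ((n : ℝ) + 1) / 2, 1 / ((n : ℝ) + 1), by positivity, half_lt_self (by positivity)⟩

theorem tendsto_timeBump_rOut : Tendsto (fun n => (timeBump n).rOut) atTop (𝓝 0) :=
  tendsto_one_div_add_atTop_nhds_zero_nat

/-- Times at which the smooth time averages of `f` converge to `f`. -/
def IsRegularTime {E : Type*} [NormedAddCommGroup E] [NormedSpace ℝ E] (f : ℝ → E) (t : ℝ) :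
    Prop :=
  Tendsto (fun n => ∫ s, (timeBump n).normed volume (t - s) • f s) atTop (𝓝 (f t))

/-- Lebesgue differentiation for bumps whose outer and inner radii have bounded ratio; `timeBump`
has ratio 2, hence `K := 2`. -/
theorem ae_isRegularTime {E : Type*} [NormedAddCommGroup E] [NormedSpace ℝ E] [CompleteSpace E]
    {f : ℝ → E} (hf : LocallyIntegrable f volume) : ∀ᵐ t, IsRegularTime f t := by
  have h := ContDiffBump.ae_convolution_tendsto_right_of_locallyIntegrable (K := 2)
    tendsto_timeBump_rOut (Eventually.of_forall fun n => by
      simp only [timeBump]; linarith) hf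
  filter_upwards [h] with t ht
  refine ht.congr fun n => ?_
  rw [convolution_lsmul_swap]

/-- A smoothed Heaviside function at t: the primitive from 0 of the bump centred at t. By `ht` the
bump lives at positive times, so the primitive starts before it. -/
theorem exists_smooth_step (b : ContDiffBump (0 : ℝ)) {t : ℝ} (ht : b.rOut < t) :
    ∃ F : ℝ → ℝ, (∀ s, HasDerivAt F (b.normed volume (t - s)) s) ∧ ContDiff ℝ ∞ F ∧
      (∀ s ≤ t - b.rOut, F s = 0) ∧ (∀ s, t + b.rOut ≤ s → F s = 1) ∧
      ∀ s, 0 ≤ F s ∧ F s ≤ 1 := by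
  set m : ℝ → ℝ := fun s => b.normed volume (t - s)
  have hm : ContDiff ℝ ∞ m := by
    exact b.contDiff_normed.comp (contDiff_const.sub contDiff_id)
  have hm0 : ∀ s, b.rOut ≤ |t - s| → m s = 0 := by
    intro s hs
    have h1 : t - s ∉ Function.support (b.normed volume) := by
      rw [b.support_normed_eq, mem_ball_zero_iff, Real.norm_eq_abs]
      exact not_lt.2 hs
    exact Function.notMem_support.1 h1
  have hd : ∀ s, HasDerivAt (fun s => ∫ r in (0 : ℝ)..s, m r) (m s) s := fun s =>
    hm.continuous.integral_hasStrictDerivAt 0 s |>.hasDerivAt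
  have h0 : ∀ s ≤ t - b.rOut, ∫ r in (0 : ℝ)..s, m r = 0 := by
    intro s hs
    refine (intervalIntegral.integral_congr (g := fun _ => 0) fun r hr => hm0 r ?_).trans (by simp)
    have : r ≤ t - b.rOut := hr.2.trans (max_le (by linarith) hs)
    exact le_trans (by linarith) (le_abs_self _)
  have h1 : ∀ s, t + b.rOut ≤ s → ∫ r in (0 : ℝ)..s, m r = 1 := by
    intro s hs
    rw [intervalIntegral.integral_eq_integral_of_support_subset,
      integral_sub_left_eq_self (fun r => b.normed volume r) volume t, b.integral_normed]
    intro r hr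
    have h2 : |t - r| < b.rOut := by
      by_contra h
      exact hr (hm0 r (not_lt.1 h))
    rw [abs_lt] at h2
    exact ⟨by linarith, by linarith⟩
  have hmono : Monotone fun s => ∫ r in (0 : ℝ)..s, m r :=
    monotone_of_deriv_nonneg (fun s => (hd s).differentiableAt) fun s => by
      rw [(hd s).deriv]
      exact b.nonneg_normed _
  refine ⟨_, hd, ?_, h0, h1, fun s => ⟨?_, ?_⟩⟩
  · rw [contDiff_infty_iff_deriv]
    exact ⟨fun s => (hd s).differentiableAt, by rwa [funext fun s => (hd s).deriv]⟩
  · exact (h0 (min s (t - b.rOut)) (min_le_right _ _)).ge.trans (hmono (min_le_left _ _))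
  · exact (hmono (le_max_left _ _)).trans (h1 (max s (t + b.rOut)) (le_max_right _ _)).le

/-- If `d/dt ⟨f, ψ⟩ = -g` in the sense of distributions and `|g| ≤ b`, then
`|⟨f t₂ - f t₁, ψ⟩| ≤ ∫ b` between regular times. -/
theorem abs_inner_sub_le_integral {E : Type*} [NormedAddCommGroup E] [InnerProductSpace ℝ E]
    [CompleteSpace E] {f : ℝ → E} {ψ : E} {g b : ℝ → ℝ} (hf : LocallyIntegrable f volume)
    (hb : LocallyIntegrable b volume) (hgb : ∀ᵐ t, |g t| ≤ b t)
    (h : ∀ θ : ℝ → ℝ, ContDiff ℝ ∞ θ → HasCompactSupport θ → (∀ s ≤ 0, θ s = 0) →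
      ∫ s, deriv θ s * inner ℝ (f s) ψ = ∫ s, θ s * g s)
    {t₁ t₂ : ℝ} (h0 : 0 < t₁) (h12 : t₁ < t₂) (ht₁ : IsRegularTime f t₁)
    (ht₂ : IsRegularTime f t₂) :
    |inner ℝ (f t₂ - f t₁) ψ| ≤ ∫ s in t₁..t₂, b s := by
  have hbi : ∀ x y, IntervalIntegrable b volume x y := fun x y =>
    (intervalIntegrable_iff).2 ((hb.integrableOn_isCompact isCompact_uIcc).mono_set uIoc_subset_uIcc)
  have hint : ∀ (n : ℕ) (t : ℝ),
      Integrable (fun s => (timeBump n).normed volume (t - s) • f s) volume := fun n t =>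
    hf.integrable_smul_left_of_hasCompactSupport
      ((timeBump n).continuous_normed.comp (continuous_const.sub continuous_id))
      ((timeBump n).hasCompactSupport_normed.comp_homeomorph (Homeomorph.subLeft t))
  have hlim := (Tendsto.inner (𝕜 := ℝ) (ht₂.sub ht₁) (tendsto_const_nhds (x := ψ))).abs
  have hB : Continuous fun x => ∫ s in (0 : ℝ)..x, b s := intervalIntegral.continuous_primitive hbi 0
  have hlimB : Tendsto (fun n => ∫ s in (t₁ - (timeBump n).rOut)..(t₂ + (timeBump n).rOut), b s)
      atTop (𝓝 (∫ s in t₁..t₂, b s)) := by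
    have e : ∀ x y, ∫ s in x..y, b s = (∫ s in (0 : ℝ)..y, b s) - ∫ s in (0 : ℝ)..x, b s :=
      fun x y => (intervalIntegral.integral_interval_sub_left (hbi _ _) (hbi _ _)).symm
    rw [e t₁ t₂]
    refine Tendsto.congr (fun n => (e _ _).symm) (Tendsto.sub ?_ ?_)
    · exact (hB.tendsto t₂).comp (by simpa using tendsto_timeBump_rOut.const_add t₂)
    · exact (hB.tendsto t₁).comp (by simpa using tendsto_timeBump_rOut.const_sub t₁)
  refine le_of_tendsto_of_tendsto hlim hlimB ?_
  filter_upwards [tendsto_timeBump_rOut.eventually (gt_mem_nhds h0)] with n hn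
  obtain ⟨F, hFd, hFs, hF0, hF1, hF⟩ := exists_smooth_step (timeBump n) hn
  obtain ⟨F', hFd', hFs', hF0', hF1', hF'⟩ := exists_smooth_step (timeBump n) (hn.trans h12)
  have hr := (timeBump n).rOut_pos
  set r := (timeBump n).rOut
  have hz : ∀ s, s ∉ Ioc (t₁ - r) (t₂ + r) → F s - F' s = 0 := by
    intro s hs
    rw [mem_Ioc, not_and_or, not_lt, not_le] at hs
    rcases hs with hs | hs
    · rw [hF0 s hs, hF0' s (by linarith), sub_zero]
    · rw [hF1 s (by linarith), hF1' s hs.le, sub_self]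
  -- The test function is a smoothed indicator of [t₁, t₂]. Its derivative is the bump at t₁ minus
  -- the bump at t₂, which produces the averaged increment; it vanishes for s ≤ 0 because r < t₁.
  have h1 := h (fun s => F s - F' s) (hFs.sub hFs')
    (HasCompactSupport.intro (isCompact_Icc (a := t₁ - r) (b := t₂ + r))
      fun s hs => hz s fun h => hs (Ioc_subset_Icc_self h))
    (fun s hs => hz s fun h => by have := h.1; linarith)
  have h2 : ∫ s, deriv (fun s => F s - F' s) s * inner ℝ (f s) ψ
      = - inner ℝ ((∫ s, (timeBump n).normed volume (t₂ - s) • f s)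
        - ∫ s, (timeBump n).normed volume (t₁ - s) • f s) ψ := by
    rw [← inner_neg_left, neg_sub, ← integral_sub (hint n t₁) (hint n t₂), real_inner_comm,
      ← integral_inner (f := fun s => (timeBump n).normed volume (t₁ - s) • f s
        - (timeBump n).normed volume (t₂ - s) • f s) ((hint n t₁).sub (hint n t₂))]
    refine integral_congr_ae (Eventually.of_forall fun s => ?_)
    simp only [((hFd s).fun_sub (hFd' s)).deriv, ← sub_smul, real_inner_smul_right,
      real_inner_comm (f s)]
  have h3 : |∫ s, (F s - F' s) * g s| ≤ ∫ s in (t₁ - r)..(t₂ + r), b s := by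
    have h4 : ∫ s, (F s - F' s) * g s = ∫ s in Ioc (t₁ - r) (t₂ + r), (F s - F' s) * g s := by
      refine (setIntegral_eq_integral_of_forall_compl_eq_zero fun s hs => ?_).symm
      rw [hz s hs, zero_mul]
    rw [h4, intervalIntegral.integral_of_le (by linarith), ← Real.norm_eq_abs]
    refine norm_integral_le_of_norm_le (hbi _ _).1 ?_
    filter_upwards [ae_restrict_of_ae hgb] with s hs
    rw [norm_mul, Real.norm_eq_abs, Real.norm_eq_abs]
    have h5 : |F s - F' s| ≤ 1 := by
      rw [abs_le]
      have := hF s; have := hF' s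
      constructor <;> linarith
    exact (mul_le_of_le_one_left (abs_nonneg _) h5).trans hs
  rw [← h1, h2, abs_neg] at h3
  exact h3

/-! ### The nonlinear term tested against a bounded field -/

/-- The pointwise adjoint of the nonlinearity: `⟨w, advectAdjoint j a v⟩ = vⱼ ⟨w, a⟩ + ½ wⱼ ⟨v, a⟩`. -/
noncomputable def advectAdjoint (j : Fin 3) (a v : R3) : R3 :=
  v j • a + (1 / 2 * inner ℝ v a) • unitVec j

/-- With w = ∂ⱼv, the sum over j is the pairing of (v·∇)v + ½(div v)v with a. All derivatives are on
one side, so for bounded a the other side is a bounded operator applied to v. -/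
theorem inner_advectAdjoint (j : Fin 3) (a v w : R3) :
    inner ℝ w (advectAdjoint j a v) = v j * inner ℝ w a + 1 / 2 * w j * inner ℝ v a := by
  simp only [advectAdjoint, inner_add_right, real_inner_smul_right, EuclideanSpace.inner_single_right]
  simp
  ring

theorem norm_advectAdjoint_le (j : Fin 3) {a : R3} {M : ℝ} (ha : ‖a‖ ≤ M) (v : R3) :
    ‖advectAdjoint j a v‖ ≤ 3 / 2 * M * ‖v‖ := by
  have h1 : ‖v j‖ * ‖a‖ ≤ ‖v‖ * M :=
    mul_le_mul (PiLp.norm_apply_le v j) ha (norm_nonneg _) (norm_nonneg _)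
  have h2 : ‖(inner ℝ v a : ℝ)‖ ≤ ‖v‖ * M :=
    (norm_inner_le_norm v a).trans (mul_le_mul_of_nonneg_left ha (norm_nonneg _))
  refine (norm_add_le _ _).trans ?_
  rw [norm_smul, norm_smul, norm_mul]
  simp only [PiLp.norm_single, norm_one, mul_one]
  norm_num at h2 ⊢
  norm_num at h1
  linarith

theorem memLp_advectAdjoint (j : Fin 3) {ψ : R3 → R3} (hψ : Continuous ψ) {M : ℝ}
    (hM : ∀ x, ‖ψ x‖ ≤ M) (v : VectorL2) :
    MemLp (fun x => advectAdjoint j (ψ x) (v x)) 2 volume := by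
  have hc : Continuous fun q : R3 × R3 => advectAdjoint j q.1 q.2 := by
    unfold advectAdjoint
    fun_prop
  exact (Lp.memLp v).of_le_mul (c := 3 / 2 * M)
    (hc.comp_aestronglyMeasurable (hψ.aestronglyMeasurable.prodMk (Lp.aestronglyMeasurable v)))
    (Eventually.of_forall fun x => norm_advectAdjoint_le j (hM x) _)

/-- The operator `v ↦ advectAdjoint j ψ v` on `L²`. -/
noncomputable def advectOp (j : Fin 3) {ψ : R3 → R3} (hψ : Continuous ψ) {M : ℝ}
    (hM : ∀ x, ‖ψ x‖ ≤ M) : VectorL2 →L[ℝ] VectorL2 :=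
  LinearMap.mkContinuous
    { toFun := fun v => (memLp_advectAdjoint j hψ hM v).toLp
      map_add' := fun v w => by
        apply Lp.ext
        filter_upwards [(memLp_advectAdjoint j hψ hM (v + w)).coeFn_toLp,
          (memLp_advectAdjoint j hψ hM v).coeFn_toLp, (memLp_advectAdjoint j hψ hM w).coeFn_toLp,
          Lp.coeFn_add v w, Lp.coeFn_add (memLp_advectAdjoint j hψ hM v).toLp
            (memLp_advectAdjoint j hψ hM w).toLp] with x h1 h2 h3 h4 h5
        rw [h1, h5, Pi.add_apply, h2, h3, h4, Pi.add_apply]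
        simp only [advectAdjoint, PiLp.add_apply, inner_add_left]
        module
      map_smul' := fun c v => by
        apply Lp.ext
        filter_upwards [(memLp_advectAdjoint j hψ hM (c • v)).coeFn_toLp,
          (memLp_advectAdjoint j hψ hM v).coeFn_toLp,
          Lp.coeFn_smul c v, Lp.coeFn_smul c (memLp_advectAdjoint j hψ hM v).toLp]
          with x h1 h2 h3 h4
        rw [RingHom.id_apply, h1, h4, Pi.smul_apply, h2, h3, Pi.smul_apply]
        simp only [advectAdjoint, PiLp.smul_apply, smul_eq_mul, real_inner_smul_left]
        module }
    (3 / 2 * M) fun v => by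
      refine Lp.norm_le_mul_norm_of_ae_le_mul ?_
      filter_upwards [(memLp_advectAdjoint j hψ hM v).coeFn_toLp] with x hx
      simp only [LinearMap.coe_mk, AddHom.coe_mk]
      rw [hx]
      exact norm_advectAdjoint_le j (hM x) _

theorem coeFn_advectOp (j : Fin 3) {ψ : R3 → R3} (hψ : Continuous ψ) {M : ℝ}
    (hM : ∀ x, ‖ψ x‖ ≤ M) (v : VectorL2) :
    advectOp j hψ hM v =ᵐ[volume] fun x => advectAdjoint j (ψ x) (v x) :=
  (memLp_advectAdjoint j hψ hM v).coeFn_toLp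

theorem norm_advectOp_apply_le (j : Fin 3) {ψ : R3 → R3} (hψ : Continuous ψ) {M : ℝ}
    (hM : ∀ x, ‖ψ x‖ ≤ M) (v : VectorL2) : ‖advectOp j hψ hM v‖ ≤ 3 / 2 * M * ‖v‖ := by
  have hM0 : 0 ≤ M := (norm_nonneg _).trans (hM 0)
  exact ContinuousLinearMap.le_of_opNorm_le _
    (LinearMap.mkContinuous_norm_le _ (by positivity) _) v

/-! ### The momentum equation for test fields in product form -/

/-- The momentum flux `-⟨p, div ψ⟩ + ∑ ⟨∂ⱼu, ∂ⱼψ⟩ + ⟨(u·∇)u + ½ (div u) u, ψ⟩`, in terms of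
elements `Ψ j`, `dΨ` and operators `A j` of `L²` representing `∂ⱼψ`, `div ψ` and the nonlinearity. -/
noncomputable def flux (Ψ : Fin 3 → VectorL2) (dΨ : ScalarL2) (A : Fin 3 → VectorL2 →L[ℝ] VectorL2)
    (v : VectorL2) (q : ScalarL2) (E : Fin 3 → VectorL2) : ℝ :=
  -inner ℝ q dΨ + ∑ j, inner ℝ (E j) (Ψ j) + ∑ j, inner ℝ (E j) (A j v)

/-- Cauchy–Schwarz term by term. The pressure enters only through the norm of div ψ, the quantity
that the cutoff argument sends to zero. -/
theorem abs_flux_le {Ψ : Fin 3 → VectorL2} {dΨ : ScalarL2} {A : Fin 3 → VectorL2 →L[ℝ] VectorL2}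
    {H K N : ℝ} (hd : ‖dΨ‖ ≤ H) (hΨ : ∀ j, ‖Ψ j‖ ≤ K) (hA : ∀ j v, ‖A j v‖ ≤ N * ‖v‖)
    (v : VectorL2) (q : ScalarL2) (E : Fin 3 → VectorL2) :
    |flux Ψ dΨ A v q E| ≤ H * ‖q‖ + K * ∑ j, ‖E j‖ + N * (‖v‖ * ∑ j, ‖E j‖) := by
  refine (abs_add_le _ _).trans (add_le_add ((abs_add_le _ _).trans (add_le_add ?_ ?_)) ?_)
  · rw [abs_neg, mul_comm]
    exact (abs_real_inner_le_norm _ _).trans (mul_le_mul_of_nonneg_left hd (norm_nonneg _))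
  · rw [Finset.mul_sum]
    refine (Finset.abs_sum_le_sum_abs _ _).trans (Finset.sum_le_sum fun j _ => ?_)
    rw [mul_comm]
    exact (abs_real_inner_le_norm _ _).trans (mul_le_mul_of_nonneg_left (hΨ j) (norm_nonneg _))
  · rw [← mul_assoc, Finset.mul_sum]
    refine (Finset.abs_sum_le_sum_abs _ _).trans (Finset.sum_le_sum fun j _ => ?_)
    rw [mul_comm]
    exact (abs_real_inner_le_norm _ _).trans (mul_le_mul_of_nonneg_left (hA j v) (norm_nonneg _))

theorem timeDeriv_smul {θ : ℝ → ℝ} {ψ : R3 → R3} (hθ : ContDiff ℝ ∞ θ) (hψ : ContDiff ℝ ∞ ψ)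
    (t : ℝ) (x : R3) :
    timeDeriv (fun q : ℝ × R3 => θ q.1 • ψ q.2) t x = deriv θ t • ψ x := by
  have h1 := (hθ.differentiable (by simp) t).hasFDerivAt.comp (t, x)
    (hasFDerivAt_fst (𝕜 := ℝ) (p := (t, x)))
  have h2 := (hψ.differentiable (by simp) x).hasFDerivAt.comp (t, x)
    (hasFDerivAt_snd (𝕜 := ℝ) (p := (t, x)))
  have h := (h1.smul h2).fderiv
  simp only [timeDeriv]
  erw [h]
  simp

theorem spaceDeriv_smul {θ : ℝ → ℝ} {ψ : R3 → R3} (hθ : ContDiff ℝ ∞ θ) (hψ : ContDiff ℝ ∞ ψ)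
    (j : Fin 3) (t : ℝ) (x : R3) :
    spaceDeriv (fun q : ℝ × R3 => θ q.1 • ψ q.2) j t x = θ t • fderiv ℝ ψ x (unitVec j) := by
  have h1 := (hθ.differentiable (by simp) t).hasFDerivAt.comp (t, x)
    (hasFDerivAt_fst (𝕜 := ℝ) (p := (t, x)))
  have h2 := (hψ.differentiable (by simp) x).hasFDerivAt.comp (t, x)
    (hasFDerivAt_snd (𝕜 := ℝ) (p := (t, x)))
  have h := (h1.smul h2).fderiv
  simp only [spaceDeriv]
  erw [h]
  simp

/-- For test fields θ(t)ψ(x), the weak momentum equation becomes the scalar distributional equation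
d/dt ⟨u, ψ⟩ = -flux for t > 0. -/
theorem integral_momentum_slice {θ : ℝ → ℝ} {ψ : R3 → R3} (hθ : ContDiff ℝ ∞ θ)
    (hψ : ContDiff ℝ ∞ ψ) {M : ℝ} (hM : ∀ x, ‖ψ x‖ ≤ M) {Ψ₀ : VectorL2} (hΨ₀ : Ψ₀ =ᵐ[volume] ψ)
    {Ψ : Fin 3 → VectorL2} (hΨ : ∀ j, Ψ j =ᵐ[volume] fun x => fderiv ℝ ψ x (unitVec j))
    {dΨ : ScalarL2} (hdΨ : dΨ =ᵐ[volume] fun x => ∑ j, fderiv ℝ ψ x (unitVec j) j)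
    (v : VectorL2) (q : ScalarL2) (E : Fin 3 → VectorL2) (t : ℝ) :
    ∫ x, (- inner ℝ (v x) (timeDeriv (fun q : ℝ × R3 => θ q.1 • ψ q.2) t x)
        - q x * (∑ j, spaceDeriv (fun q : ℝ × R3 => θ q.1 • ψ q.2) j t x j)
        + (∑ j, inner ℝ (E j x) (spaceDeriv (fun q : ℝ × R3 => θ q.1 • ψ q.2) j t x))
        + inner ℝ (∑ j, v x j • E j x) (θ t • ψ x)
        + (1 / 2) * (∑ j, E j x j) * inner ℝ (v x) (θ t • ψ x))
      = - (deriv θ t * inner ℝ v Ψ₀)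
        + θ t * flux Ψ dΨ (fun j => advectOp j hψ.continuous hM) v q E := by
  have hA : ∀ᵐ x, ∀ j, advectOp j hψ.continuous hM v x = advectAdjoint j (ψ x) (v x) :=
    ae_all_iff.2 fun j => coeFn_advectOp j hψ.continuous hM v
  have hi0 := (L2.integrable_inner (𝕜 := ℝ) v Ψ₀)
  have hi1 := (L2.integrable_inner (𝕜 := ℝ) q dΨ)
  have hi2 : Integrable (fun x => ∑ j, inner ℝ (E j x) (Ψ j x)) volume :=
    integrable_finsetSum _ fun j _ => L2.integrable_inner (𝕜 := ℝ) (E j) (Ψ j)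
  have hi3 : Integrable (fun x => ∑ j, inner ℝ (E j x) (advectOp j hψ.continuous hM v x)) volume :=
    integrable_finsetSum _ fun j _ => L2.integrable_inner (𝕜 := ℝ) (E j) _
  have h1 : ∫ x, (- (deriv θ t * inner ℝ (v x) (Ψ₀ x)) + θ t * (-inner ℝ (q x) (dΨ x)
      + ∑ j, inner ℝ (E j x) (Ψ j x)
      + ∑ j, inner ℝ (E j x) (advectOp j hψ.continuous hM v x)))
      = - (deriv θ t * inner ℝ v Ψ₀)
        + θ t * flux Ψ dΨ (fun j => advectOp j hψ.continuous hM) v q E := by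
    have hi4 : Integrable (fun x => -(deriv θ t * inner ℝ (v x) (Ψ₀ x))) volume :=
      (hi0.const_mul _).neg
    have hi5 : Integrable (fun x => -(inner ℝ (q x) (dΨ x) : ℝ)) volume := hi1.neg
    have hi6 : Integrable (fun x => -inner ℝ (q x) (dΨ x) + ∑ j, inner ℝ (E j x) (Ψ j x)) volume :=
      hi5.add hi2
    have hi7 : Integrable (fun x => -inner ℝ (q x) (dΨ x) + ∑ j, inner ℝ (E j x) (Ψ j x)
      + ∑ j, inner ℝ (E j x) (advectOp j hψ.continuous hM v x)) volume := hi6.add hi3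
    rw [integral_add hi4 (hi7.const_mul _), integral_neg, integral_const_mul, integral_const_mul,
      integral_add hi6 hi3, integral_add hi5 hi2, integral_neg,
      integral_finsetSum _ fun j _ => L2.integrable_inner (𝕜 := ℝ) (E j) (Ψ j),
      integral_finsetSum _ fun j _ => L2.integrable_inner (𝕜 := ℝ) (E j) _]
    simp only [flux, L2.inner_def]
  rw [← h1]
  refine integral_congr_ae ?_
  filter_upwards [hΨ₀, ae_all_iff.2 hΨ, hdΨ, hA] with x e0 e1 e2 e3
  simp only [timeDeriv_smul hθ hψ, spaceDeriv_smul hθ hψ, e0, e1, e2, e3, inner_advectAdjoint,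
    real_inner_smul_right, PiLp.smul_apply, smul_eq_mul,
    Fin.sum_univ_three, RCLike.inner_apply, conj_trivial, inner_add_left, real_inner_smul_left]
  ring

/-! ### Local integrability in time -/

/-- Extension by zero to t ≤ 0, so that convolution in time can be done on the whole line. -/
theorem locallyIntegrable_indicator {F : Type*} [NormedAddCommGroup F] {f : ℝ → F}
    (hf : ∀ T : ℝ, 0 < T → IntegrableOn f (Ioc 0 T) volume) :
    LocallyIntegrable ((Ioi (0 : ℝ)).indicator f) volume := by
  rw [locallyIntegrable_iff]
  intro K hK
  obtain ⟨R, hR⟩ := hK.isBounded.subset_closedBall 0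
  rw [integrableOn_indicator_iff measurableSet_Ioi]
  refine (hf (max R 1) (by positivity)).mono_set fun t ht => ⟨ht.1, ?_⟩
  have := hR ht.2
  rw [mem_closedBall_zero_iff, Real.norm_eq_abs] at this
  exact (le_abs_self t).trans (this.trans (le_max_left _ _))

namespace IsWeakSolutionWithGradient

variable {ε : ℝ} {u₀ : VectorL2} {p₀ : ScalarL2} {u : ℝ → VectorL2} {p : ℝ → ScalarL2}
  {D : Fin 3 → ℝ → VectorL2}

theorem integrableOn_velocity (hs : IsWeakSolutionWithGradient ε u₀ p₀ u p D) {T : ℝ}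
    (hT : 0 < T) : IntegrableOn u (Ioc 0 T) volume :=
  (hs.velocity_memLp T hT).integrable (by simp)

/-- Purely qualitative: dividing by √ε is harmless because only finiteness of ∫‖p‖ is needed for
each fixed solution. -/
theorem integrableOn_pressure (hs : IsWeakSolutionWithGradient ε u₀ p₀ u p D) (hε : 0 < ε) {T : ℝ}
    (hT : 0 < T) : IntegrableOn p (Ioc 0 T) volume := by
  have h := ((hs.pressure_memLp T hT).integrable (by simp)).smul (Real.sqrt ε)⁻¹
  refine h.congr (Eventually.of_forall fun t => ?_)
  simp [smul_smul, inv_mul_cancel₀ (Real.sqrt_pos.2 hε).ne']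

theorem integrableOn_gradient (hs : IsWeakSolutionWithGradient ε u₀ p₀ u p D) {T : ℝ}
    (hT : 0 < T) (j : Fin 3) : IntegrableOn (D j) (Ioc 0 T) volume :=
  (hs.gradient_memLp T hT j).integrable (by norm_num)

theorem integrableOn_sum_norm_gradient (hs : IsWeakSolutionWithGradient ε u₀ p₀ u p D) {T : ℝ}
    (hT : 0 < T) : IntegrableOn (fun t => ∑ j, ‖D j t‖) (Ioc 0 T) volume :=
  integrable_finsetSum _ fun j _ => (hs.integrableOn_gradient hT j).norm

theorem integrableOn_norm_mul_sum (hs : IsWeakSolutionWithGradient ε u₀ p₀ u p D) {T : ℝ}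
    (hT : 0 < T) : IntegrableOn (fun t => ‖u t‖ * ∑ j, ‖D j t‖) (Ioc 0 T) volume :=
  (hs.integrableOn_sum_norm_gradient hT).mul_of_top_right (hs.velocity_memLp T hT).norm

theorem integrableOn_flux (hs : IsWeakSolutionWithGradient ε u₀ p₀ u p D) (hε : 0 < ε)
    (Ψ : Fin 3 → VectorL2) (dΨ : ScalarL2) (A : Fin 3 → VectorL2 →L[ℝ] VectorL2) {N : ℝ}
    (hA : ∀ j v, ‖A j v‖ ≤ N * ‖v‖) {T : ℝ} (hT : 0 < T) :
    IntegrableOn (fun t => flux Ψ dΨ A (u t) (p t) fun j => D j t) (Ioc 0 T) volume := by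
  have hb := ((((hs.integrableOn_pressure hε hT).norm).const_mul ‖dΨ‖).add
    ((hs.integrableOn_sum_norm_gradient hT).const_mul (∑ j, ‖Ψ j‖))).add
    ((hs.integrableOn_norm_mul_sum hT).const_mul N)
  refine Integrable.mono' hb ?_ (Eventually.of_forall fun t => ?_)
  · have hu := (hs.integrableOn_velocity hT).aestronglyMeasurable
    have hp := (hs.integrableOn_pressure hε hT).aestronglyMeasurable
    have hD := fun j => (hs.integrableOn_gradient hT j).aestronglyMeasurable
    unfold flux
    refine ((hp.inner aestronglyMeasurable_const).neg.add ?_).add ?_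
    · exact Finset.aestronglyMeasurable_fun_sum _ fun j _ => (hD j).inner aestronglyMeasurable_const
    · exact Finset.aestronglyMeasurable_fun_sum _ fun j _ =>
        (hD j).inner ((A j).continuous.comp_aestronglyMeasurable hu)
  · exact abs_flux_le le_rfl
      (fun j => Finset.single_le_sum (fun i _ => norm_nonneg (Ψ i)) (Finset.mem_univ j)) hA _ _ _

/-- Increments of the velocity tested against a test field. -/
theorem abs_inner_increment_le (hs : IsWeakSolutionWithGradient ε u₀ p₀ u p D) (hε : 0 < ε)
    {t₁ t₂ : ℝ} (h0 : 0 < t₁) (h12 : t₁ < t₂)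
    (ht₁ : IsRegularTime ((Ioi (0 : ℝ)).indicator u) t₁)
    (ht₂ : IsRegularTime ((Ioi (0 : ℝ)).indicator u) t₂)
    {ψ : R3 → R3} {M G H : ℝ} (hψ : ContDiff ℝ ∞ ψ) (hψc : HasCompactSupport ψ)
    (hM : ∀ x, ‖ψ x‖ ≤ M) (hG0 : 0 ≤ G) (hH0 : 0 ≤ H)
    (hG : ∀ j, eLpNorm (fun x => fderiv ℝ ψ x (unitVec j)) 2 volume ≤ ENNReal.ofReal G)
    (hH : eLpNorm (fun x => ∑ j, fderiv ℝ ψ x (unitVec j) j) 2 volume ≤ ENNReal.ofReal H) :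
    |∫ x, inner ℝ ((u t₂ - u t₁) x) (ψ x)| ≤
      (∫ t in t₁..t₂, ‖p t‖) * H + (∫ t in t₁..t₂, ∑ j, ‖D j t‖) * G
        + (3 / 2 * ∫ t in t₁..t₂, ‖u t‖ * ∑ j, ‖D j t‖) * M := by
  have m0 : MemLp ψ 2 volume := hψ.continuous.memLp_of_hasCompactSupport hψc
  have mj : ∀ j, MemLp (fun x => fderiv ℝ ψ x (unitVec j)) 2 volume := fun j =>
    (contDiff_fderiv_apply hψ _).continuous.memLp_of_hasCompactSupport
      (hasCompactSupport_fderiv_apply hψc _)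
  have md : MemLp (fun x => ∑ j, fderiv ℝ ψ x (unitVec j) j) 2 volume :=
    memLp_finsetSum _ fun j _ =>
      (EuclideanSpace.proj j : R3 →L[ℝ] ℝ).comp_memLp' (mj j)
  set A : Fin 3 → VectorL2 →L[ℝ] VectorL2 := fun j => advectOp j hψ.continuous hM
  have hA : ∀ j v, ‖A j v‖ ≤ 3 / 2 * M * ‖v‖ := fun j => norm_advectOp_apply_le j hψ.continuous hM
  have hΨ : ∀ j, ‖(mj j).toLp‖ ≤ G := fun j => by
    rw [Lp.norm_toLp]
    exact ENNReal.toReal_le_of_le_ofReal hG0 (hG j)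
  have hdΨ : ‖md.toLp‖ ≤ H := by
    rw [Lp.norm_toLp]
    exact ENNReal.toReal_le_of_le_ofReal hH0 hH
  set g : ℝ → ℝ := fun t => flux (fun j => (mj j).toLp) md.toLp A (u t) (p t) fun j => D j t
  set b : ℝ → ℝ := fun t => H * ‖p t‖ + G * (∑ j, ‖D j t‖) + 3 / 2 * M * (‖u t‖ * ∑ j, ‖D j t‖)
  have hbi : ∀ T : ℝ, 0 < T → IntegrableOn b (Ioc 0 T) volume := fun T hT =>
    ((((hs.integrableOn_pressure hε hT).norm).const_mul H).add
    ((hs.integrableOn_sum_norm_gradient hT).const_mul G)).add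
    ((hs.integrableOn_norm_mul_sum hT).const_mul (3 / 2 * M))
  have hgl : LocallyIntegrable ((Ioi (0 : ℝ)).indicator g) volume :=
    locallyIntegrable_indicator fun T hT => hs.integrableOn_flux hε _ _ _ hA hT
  have hul : LocallyIntegrable ((Ioi (0 : ℝ)).indicator u) volume :=
    locallyIntegrable_indicator fun T hT => hs.integrableOn_velocity hT
  have key := abs_inner_sub_le_integral (ψ := m0.toLp ψ) (g := (Ioi (0 : ℝ)).indicator g)
    hul (locallyIntegrable_indicator hbi)
    (Eventually.of_forall fun t => ?_) (fun θ hθ hθc hθ0 => ?_) h0 h12 ht₁ ht₂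
  · have hsub : Ioc t₁ t₂ ⊆ Ioc 0 t₂ := Ioc_subset_Ioc_left h0.le
    have h02 := h0.trans h12
    have e1 : ∫ s in t₁..t₂, (Ioi (0 : ℝ)).indicator b s = ∫ s in t₁..t₂, b s := by
      refine intervalIntegral.integral_congr fun s hs => indicator_of_mem ?_ _
      rw [uIcc_of_le h12.le] at hs
      exact h0.trans_le hs.1
    rw [indicator_of_mem (mem_Ioi.2 h0), indicator_of_mem (mem_Ioi.2 h02), e1, L2.inner_def] at key
    have e2 : ∫ x, inner ℝ ((u t₂ - u t₁) x) (m0.toLp ψ x) = ∫ x, inner ℝ ((u t₂ - u t₁) x) (ψ x) := by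
      refine integral_congr_ae ?_
      filter_upwards [m0.coeFn_toLp] with x hx
      rw [hx]
    rw [e2] at key
    refine key.trans (le_of_eq ?_)
    have ii : ∀ {f : ℝ → ℝ}, IntegrableOn f (Ioc 0 t₂) volume → IntervalIntegrable f volume t₁ t₂ :=
      fun h => (intervalIntegrable_iff_integrableOn_Ioc_of_le h12.le).2 (h.mono_set hsub)
    have i1 := ii (hs.integrableOn_pressure hε h02).norm
    have i2 := ii (hs.integrableOn_sum_norm_gradient h02)
    have i3 := ii (hs.integrableOn_norm_mul_sum h02)
    simp only [b]
    rw [intervalIntegral.integral_add ((i1.const_mul _).add (i2.const_mul _)) (i3.const_mul _),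
      intervalIntegral.integral_add (i1.const_mul _) (i2.const_mul _),
      intervalIntegral.integral_const_mul, intervalIntegral.integral_const_mul,
      intervalIntegral.integral_const_mul]
    ring
  · by_cases ht : t ∈ Ioi (0 : ℝ)
    · rw [indicator_of_mem ht, indicator_of_mem ht]
      exact abs_flux_le hdΨ hΨ hA _ _ _
    · simp [indicator_of_notMem ht]
  · obtain ⟨K, hK⟩ : ∃ K : Set (ℝ × R3), IsCompact K ∧ ∀ q, q ∉ K → θ q.1 • ψ q.2 = 0 := by
      refine ⟨tsupport θ ×ˢ tsupport ψ, hθc.prod hψc, fun q hq => ?_⟩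
      rw [mem_prod, not_and_or] at hq
      rcases hq with hq | hq
      · simp [image_eq_zero_of_notMem_tsupport hq]
      · simp [image_eq_zero_of_notMem_tsupport hq]
    have h1 := hs.momentum (fun q => θ q.1 • ψ q.2) (by fun_prop) (HasCompactSupport.intro hK.1 hK.2)
    -- The initial datum disappears because θ(0) = 0.
    simp only [integral_momentum_slice hθ hψ hM m0.coeFn_toLp (fun j => (mj j).coeFn_toLp)
      md.coeFn_toLp, hθ0 0 le_rfl, zero_smul, inner_zero_right, integral_zero] at h1
    have hθ1 : Continuous (deriv θ) := hθ.continuous_deriv (by simp)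
    have j1 : Integrable (fun s => deriv θ s • (Ioi (0 : ℝ)).indicator u s) volume :=
      hul.integrable_smul_left_of_hasCompactSupport hθ1 hθc.deriv
    have j1' : Integrable (fun s => deriv θ s * inner ℝ ((Ioi (0 : ℝ)).indicator u s) (m0.toLp ψ)) volume := by
      simpa only [real_inner_smul_left] using j1.inner_const (𝕜 := ℝ) (m0.toLp ψ)
    have j2 : Integrable (fun s => θ s * (Ioi (0 : ℝ)).indicator g s) volume :=
      hgl.integrable_smul_left_of_hasCompactSupport hθ.continuous hθc
    rw [← sub_eq_zero, ← integral_sub j1' j2, ← neg_eq_zero, ← integral_neg]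
    refine Eq.trans ?_ h1
    rw [← integral_indicator measurableSet_Ioi]
    refine integral_congr_ae (Eventually.of_forall fun s => ?_)
    by_cases h : s ∈ Ioi (0 : ℝ)
    · simp only [indicator_of_mem h, g, A]
      ring
    · simp [indicator_of_notMem h]

end IsWeakSolutionWithGradient

/-! ### Mollifiers at scale `δ` -/

/-- Scaling of one bump, k(x) = δ⁻³ρ(x/δ): the `L¹` norm of a derivative scales as δ⁻¹, and the `L²`
norm as δ to minus half the dimension. -/
theorem exists_mollifier : ∃ C : ℝ, 0 ≤ C ∧ ∀ δ : ℝ, 0 < δ → ∃ k : R3 → ℝ, ContDiff ℝ ∞ k ∧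
    HasCompactSupport k ∧ (∀ y, 0 ≤ k y) ∧ ∫ y, k y = 1 ∧ (∀ y, δ < ‖y‖ → k y = 0) ∧
    (∀ j, ∫ y, ‖fderiv ℝ k y (unitVec j)‖ ≤ C * δ⁻¹) ∧
    (∫ y, ‖k y‖ ^ (2 : ℝ)) ^ (1 / 2 : ℝ) ≤ C * δ ^ (-(3 / 2) : ℝ) := by
  let b : ContDiffBump (0 : R3) := ⟨1 / 2, 1, by norm_num, by norm_num⟩
  set ρ : R3 → ℝ := b.normed volume
  have hρ : ContDiff ℝ ∞ ρ := b.contDiff_normed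
  have hρc : HasCompactSupport ρ := b.hasCompactSupport_normed
  have hscale : ∀ (δ : ℝ), 0 < δ → ∀ f : R3 → ℝ, ∫ x, f (δ⁻¹ • x) = δ ^ 3 * ∫ x, f x := by
    intro δ hδ f
    rw [Measure.integral_comp_smul]
    simp only [finrank_euclideanSpace, Fintype.card_fin, smul_eq_mul, inv_pow, inv_inv]
    rw [abs_of_pos (by positivity)]
  set C₁ : ℝ := ∑ j, ∫ y, ‖fderiv ℝ ρ y (unitVec j)‖
  set C₂ : ℝ := (∫ y, ‖ρ y‖ ^ (2 : ℝ)) ^ (1 / 2 : ℝ)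
  have hC₁ : ∀ j, ∫ y, ‖fderiv ℝ ρ y (unitVec j)‖ ≤ C₁ := fun j =>
    Finset.single_le_sum (f := fun j => ∫ y, ‖fderiv ℝ ρ y (unitVec j)‖)
      (fun i _ => integral_nonneg fun y => norm_nonneg _) (Finset.mem_univ j)
  have hC₁0 : 0 ≤ C₁ := (integral_nonneg fun y => norm_nonneg _).trans (hC₁ 0)
  have hC₂0 : 0 ≤ C₂ := by positivity
  refine ⟨C₁ + C₂, by positivity, fun δ hδ => ⟨fun x => (δ ^ 3)⁻¹ * ρ (δ⁻¹ • x), ?_, ?_, ?_, ?_, ?_,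
    ?_, ?_⟩⟩
  · fun_prop
  · exact (hρc.comp_homeomorph (Homeomorph.smulOfNeZero δ⁻¹ (by positivity))).mul_left
  · intro y
    have := b.nonneg_normed (μ := volume) (δ⁻¹ • y)
    positivity
  · rw [integral_const_mul, hscale δ hδ, b.integral_normed, mul_one, inv_mul_cancel₀ (by positivity)]
  · intro y hy
    have h1 : δ⁻¹ • y ∉ Function.support ρ := by
      rw [b.support_normed_eq, mem_ball_zero_iff, norm_smul, Real.norm_of_nonneg (by positivity),
        not_lt]
      change 1 ≤ _
      rw [← inv_mul_cancel₀ hδ.ne']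
      gcongr
    simp only [Function.notMem_support.1 h1, mul_zero]
  · intro j
    have hd : ∀ y, ‖fderiv ℝ (fun x => (δ ^ 3)⁻¹ * ρ (δ⁻¹ • x)) y (unitVec j)‖
        = (δ ^ 3)⁻¹ * (δ⁻¹ * ‖fderiv ℝ ρ (δ⁻¹ • y) (unitVec j)‖) := by
      intro y
      rw [fderiv_const_mul (show DifferentiableAt ℝ (fun x => ρ (δ⁻¹ • x)) y from
        (hρ.differentiable (by simp)).comp (differentiable_id.const_smul δ⁻¹) y), fderiv_comp_smul (f := ρ)]
      simp only [smul_apply, norm_smul, norm_inv, norm_pow,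
        Real.norm_of_nonneg hδ.le]
    simp only [hd]
    rw [integral_const_mul, integral_const_mul,
      hscale δ hδ fun y => ‖fderiv ℝ ρ y (unitVec j)‖]
    have : (δ ^ 3)⁻¹ * (δ⁻¹ * (δ ^ 3 * ∫ y, ‖fderiv ℝ ρ y (unitVec j)‖))
        = (∫ y, ‖fderiv ℝ ρ y (unitVec j)‖) * δ⁻¹ := by
      field_simp
    rw [this]
    gcongr
    linarith [hC₁ j]
  · have hd : ∀ y, ‖(δ ^ 3)⁻¹ * ρ (δ⁻¹ • y)‖ ^ (2 : ℝ)
        = ((δ ^ 3)⁻¹) ^ 2 * ‖ρ (δ⁻¹ • y)‖ ^ (2 : ℝ) := by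
      intro y
      rw [norm_mul, Real.norm_of_nonneg (by positivity : (0 : ℝ) ≤ (δ ^ 3)⁻¹)]
      norm_cast
      rw [mul_pow]
    simp only [hd]
    rw [integral_const_mul, hscale δ hδ fun y => ‖ρ y‖ ^ (2 : ℝ), ← mul_assoc,
      Real.mul_rpow (by positivity) (integral_nonneg fun y => by positivity)]
    have h3 : ((δ ^ 3)⁻¹ ^ 2 * δ ^ 3 : ℝ) ^ (1 / 2 : ℝ) = δ ^ (-(3 / 2) : ℝ) := by
      have : ((δ ^ 3)⁻¹ ^ 2 * δ ^ 3 : ℝ) = δ ^ (-3 : ℝ) := by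
        rw [Real.rpow_neg hδ.le]
        norm_cast
        field_simp
      rw [this, ← Real.rpow_mul hδ.le]
      norm_num
    rw [h3, mul_comm]
    gcongr
    linarith

/-- P commutes with translations and does not increase norms, so the estimate passes from v to Pv
without any weak derivative of Pv. -/
theorem norm_translate_lerayP_sub_le {v₁ v₂ : VectorL2} {D₁ D₂ : Fin 3 → VectorL2}
    (h₁ : ∀ j, IsWeakPartial j v₁ (D₁ j)) (h₂ : ∀ j, IsWeakPartial j v₂ (D₂ j)) (y : R3) :
    ‖translate y (lerayP (v₂ - v₁)) - lerayP (v₂ - v₁)‖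
      ≤ ‖y‖ * (∑ j, ‖D₂ j‖ + ∑ j, ‖D₁ j‖) := by
  have e : translate y (lerayP (v₂ - v₁)) - lerayP (v₂ - v₁)
      = lerayP ((translate y v₂ - v₂) - (translate y v₁ - v₁)) := by
    simp only [map_sub, ← lerayP_translate]
    abel
  rw [e, mul_add]
  exact (norm_lerayP_le _).trans ((norm_sub_le _ _).trans
    (add_le_add (norm_translate_sub_le h₂ y) (norm_translate_sub_le h₁ y)))

/-! ### Window integrals -/

/-- Each r lies in the window [t, t+h] only for t in a set of length h. In terms of the monotone
primitive B of s, the left side is ∫_T^(T+h) B - ∫_0^h B, and `h < 1` bounds B by B(T+1) on the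
first interval. -/
theorem integral_window_le {s : ℝ → ℝ} (hs : LocallyIntegrable s volume) (h0 : ∀ t, 0 ≤ s t)
    {T h : ℝ} (hh : h ∈ Ioo (0 : ℝ) 1) :
    ∫ t in (0 : ℝ)..T, (∫ r in t..(t + h), s r) ≤ h * ∫ r in (0 : ℝ)..(T + 1), s r := by
  have hi : ∀ x y, IntervalIntegrable s volume x y := fun x y =>
    intervalIntegrable_iff.2 ((hs.integrableOn_isCompact isCompact_uIcc).mono_set uIoc_subset_uIcc)
  set B : ℝ → ℝ := fun x => ∫ r in (0 : ℝ)..x, s r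
  have hB : Continuous B := intervalIntegral.continuous_primitive hi 0
  have hBd : ∀ x y, ∫ r in x..y, s r = B y - B x := fun x y =>
    (intervalIntegral.integral_interval_sub_left (hi _ _) (hi _ _)).symm
  have hBm : Monotone B := fun x y hxy => by
    rw [← sub_nonneg, ← hBd]
    exact intervalIntegral.integral_nonneg hxy fun t _ => h0 t
  have hB0 : B 0 = 0 := intervalIntegral.integral_same
  have hBi : ∀ x y, IntervalIntegrable B volume x y := fun x y => hB.intervalIntegrable x y
  simp only [hBd]
  rw [intervalIntegral.integral_sub
    (show IntervalIntegrable (fun t => B (t + h)) volume 0 T from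
      (hB.comp (continuous_add_const h)).intervalIntegrable _ _) (hBi _ _),
    intervalIntegral.integral_comp_add_right (fun t => B t) h, zero_add,
    ← intervalIntegral.integral_interval_sub_left (hBi 0 _) (hBi 0 _),
    ← intervalIntegral.integral_add_adjacent_intervals (hBi 0 T) (hBi T (T + h))]
  have h1 : ∫ t in T..(T + h), B t ≤ h * B (T + 1) := by
    have : ∫ t in T..(T + h), B t ≤ ∫ t in T..(T + h), B (T + 1) :=
      intervalIntegral.integral_mono_on (by linarith [hh.1]) (hBi _ _) (by simp)
        fun t ht => hBm (by linarith [ht.2, hh.2])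
    simpa using this
  have h2 : 0 ≤ ∫ t in (0 : ℝ)..h, B t :=
    intervalIntegral.integral_nonneg hh.1.le fun t ht => hB0.symm.le.trans (hBm ht.1)
  rw [hB0, sub_zero]
  linarith

theorem integral_shift_le {s : ℝ → ℝ} (hs : LocallyIntegrable s volume) (h0 : ∀ t, 0 ≤ s t)
    {T h : ℝ} (hT : 0 < T) (hh : h ∈ Icc (0 : ℝ) 1) :
    ∫ t in (0 : ℝ)..T, s (t + h) ≤ ∫ r in (0 : ℝ)..(T + 1), s r := by
  have hi : ∀ x y, IntervalIntegrable s volume x y := fun x y =>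
    intervalIntegrable_iff.2 ((hs.integrableOn_isCompact isCompact_uIcc).mono_set uIoc_subset_uIcc)
  rw [intervalIntegral.integral_comp_add_right s h]
  exact intervalIntegral.integral_mono_interval (by linarith [hh.1]) (by linarith)
    (by linarith [hh.2]) (Eventually.of_forall h0) (hi _ _)

namespace IsWeakSolutionWithGradient

variable {ε : ℝ} {u₀ : VectorL2} {p₀ : ScalarL2} {u : ℝ → VectorL2} {p : ℝ → ScalarL2}
  {D : Fin 3 → ℝ → VectorL2}

/-! ### Consequences of the energy inequality -/

theorem ae_norm_velocity_le (hs : IsWeakSolutionWithGradient ε u₀ p₀ u p D) (hε : 0 < ε) {E : ℝ}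
    (hE : 1 / 2 * ‖u₀‖ ^ 2 + ε / 2 * ‖p₀‖ ^ 2 ≤ E) :
    ∀ᵐ t ∂(volume.restrict (Ioi (0 : ℝ))), ‖u t‖ ≤ Real.sqrt (2 * E) := by
  filter_upwards [hs.energy] with t ht
  have h1 : 0 ≤ ∫ s in Ioc 0 t, ∑ j, ‖D j s‖ ^ 2 := integral_nonneg fun s => by positivity
  have h2 : 0 ≤ ε / 2 * ‖p t‖ ^ 2 := by positivity
  exact Real.le_sqrt_of_sq_le (by linarith)

theorem integral_sum_norm_gradient_le (hs : IsWeakSolutionWithGradient ε u₀ p₀ u p D) (hε : 0 < ε)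
    {E : ℝ} (hE : 1 / 2 * ‖u₀‖ ^ 2 + ε / 2 * ‖p₀‖ ^ 2 ≤ E) {T : ℝ} (hT : 0 < T) :
    ∫ t in (0 : ℝ)..T, ∑ j, ‖D j t‖ ≤ 3 / 2 * T + E / 2 := by
  have hsq : ∀ S : ℝ, 0 < S → IntegrableOn (fun t => ∑ j, ‖D j t‖ ^ 2) (Ioc 0 S) volume :=
    fun S hS => integrable_finsetSum _ fun j _ => (hs.gradient_memLp S hS j).integrable_norm_pow'
  have h1 : ∫ t in Ioc 0 T, ∑ j, ‖D j t‖ ^ 2 ≤ E := by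
    -- The energy inequality may fail at T itself; a good time after T bounds the dissipation up to
    -- T.
    have h2 : ∃ᵐ t ∂(volume.restrict (Ioi (0 : ℝ))), T < t := by
      rw [frequently_ae_iff, Measure.restrict_apply' measurableSet_Ioi]
      have : {t : ℝ | T < t} ∩ Ioi 0 = Ioi T := by
        ext t
        simp only [mem_inter_iff, mem_ofPred_eq, mem_Ioi]
        exact ⟨fun h => h.1, fun h => ⟨h, hT.trans h⟩⟩
      rw [this]
      simp
    obtain ⟨t, htT, ht⟩ := (h2.and_eventually hs.energy).exists
    have h3 : ∫ t in Ioc 0 T, ∑ j, ‖D j t‖ ^ 2 ≤ ∫ s in Ioc 0 t, ∑ j, ‖D j s‖ ^ 2 :=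
      setIntegral_mono_set (hsq t (hT.trans htT)) (Eventually.of_forall fun s => by
        simp only [Pi.zero_apply]; positivity)
        (Ioc_subset_Ioc_right htT.le).eventuallyLE
    have h4 : 0 ≤ ε / 2 * ‖p t‖ ^ 2 := by positivity
    have h5 : 0 ≤ 1 / 2 * ‖u t‖ ^ 2 := by positivity
    linarith
  rw [intervalIntegral.integral_of_le hT.le]
  have hc : IntegrableOn (fun _ : ℝ => (3 / 2 : ℝ)) (Ioc 0 T) volume :=
    integrableOn_const (by simp)
  -- From a ≤ ½ + ½a² for each of the three partial derivatives.
  calc ∫ t in Ioc 0 T, ∑ j, ‖D j t‖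
      ≤ ∫ t in Ioc 0 T, (3 / 2 + 1 / 2 * ∑ j, ‖D j t‖ ^ 2) := by
        refine integral_mono (hs.integrableOn_sum_norm_gradient hT)
          (hc.add ((hsq T hT).const_mul _)) fun t => ?_
        simp only [Fin.sum_univ_three]
        nlinarith [sq_nonneg (‖D 0 t‖ - 1), sq_nonneg (‖D 1 t‖ - 1), sq_nonneg (‖D 2 t‖ - 1)]
    _ = 3 / 2 * T + 1 / 2 * ∫ t in Ioc 0 T, ∑ j, ‖D j t‖ ^ 2 := by
        rw [integral_add hc ((hsq T hT).const_mul _), integral_const_mul]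
        simp [hT.le, mul_comm]
    _ ≤ 3 / 2 * T + E / 2 := by linarith

/-! ### The increment of the divergence-free part -/

/-- The splitting ‖w‖² = ⟨z, w - k⋆w⟩ + ⟨z, k⋆w⟩ with z = u(t₂) - u(t₁) and w = Pz. Mollification
error bounds the first term and the momentum equation tested with k⋆w the second; no pressure term
survives because k⋆w is divergence-free. -/
theorem norm_lerayP_increment_sq_le (hs : IsWeakSolutionWithGradient ε u₀ p₀ u p D) (hε : 0 < ε)
    {t₁ t₂ : ℝ} (h0 : 0 < t₁) (h12 : t₁ < t₂)
    (ht₁ : IsRegularTime ((Ioi (0 : ℝ)).indicator u) t₁)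
    (ht₂ : IsRegularTime ((Ioi (0 : ℝ)).indicator u) t₂)
    (hw₁ : ∀ j, IsWeakPartial j (u t₁) (D j t₁)) (hw₂ : ∀ j, IsWeakPartial j (u t₂) (D j t₂))
    {k : R3 → ℝ} (hk : ContDiff ℝ ∞ k) (hkc : HasCompactSupport k) (hk0 : ∀ y, 0 ≤ k y)
    (hk1 : ∫ y, k y = 1) {δ K L : ℝ} (hδ : ∀ y, δ < ‖y‖ → k y = 0)
    (hK : ∀ j, ∫ y, ‖fderiv ℝ k y (unitVec j)‖ ≤ K)
    (hL : (∫ y, ‖k y‖ ^ (2 : ℝ)) ^ (1 / 2 : ℝ) ≤ L) :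
    ‖lerayP (u t₂ - u t₁)‖ ^ 2 ≤ ‖u t₂ - u t₁‖ * (δ * (∑ j, ‖D j t₂‖ + ∑ j, ‖D j t₁‖))
      + ((∫ t in t₁..t₂, ∑ j, ‖D j t‖) * K
        + 3 / 2 * (∫ t in t₁..t₂, ‖u t‖ * ∑ j, ‖D j t‖) * L) * ‖u t₂ - u t₁‖ := by
  set z := u t₂ - u t₁
  set w := lerayP z
  have hwz : ‖w‖ ≤ ‖z‖ := norm_lerayP_le z
  have hK0 : 0 ≤ K := (integral_nonneg fun y => norm_nonneg _).trans (hK 0)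
  have hL0 : 0 ≤ L := le_trans (by positivity) hL
  have htr : ∀ y, ‖translate y w - w‖ ≤ ‖y‖ * (∑ j, ‖D j t₂‖ + ∑ j, ‖D j t₁‖) :=
    norm_translate_lerayP_sub_le hw₁ hw₂
  have hS0 : 0 ≤ ∑ j, ‖D j t₂‖ + ∑ j, ‖D j t₁‖ :=
    add_nonneg (Finset.sum_nonneg fun j _ => norm_nonneg _)
      (Finset.sum_nonneg fun j _ => norm_nonneg _)
  have h1 := norm_sub_mollifyL2_le hk.continuous hkc hk0 hk1 hS0 hδ htr
  have h2 : |inner ℝ z (mollifyL2 k w)| ≤ (∫ t in t₁..t₂, ∑ j, ‖D j t‖) * (K * ‖z‖)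
      + (3 / 2 * ∫ t in t₁..t₂, ‖u t‖ * ∑ j, ‖D j t‖) * (L * ‖z‖) := by
    refine abs_inner_le_of_forall_test
      (fun ψ M G H hψ hψc hM hG0 hH0 hG hH =>
        hs.abs_inner_increment_le hε h0 h12 ht₁ ht₂ hψ hψc hM hG0 hH0 hG hH)
      (contDiff_mollify hk hkc w) (coeFn_mollifyL2 hk hkc w) (fun x => ?_) (by positivity)
      (fun j => ?_) (fun x => ?_)
    · exact (norm_mollify_le hk.continuous hkc w x).trans
        (mul_le_mul hL hwz (norm_nonneg _) hL0)
    · simp only [fderiv_mollify_apply hk hkc]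
      have hk' := contDiff_fderiv_apply hk (unitVec j)
      have hkc' := hasCompactSupport_fderiv_apply hkc (unitVec j)
      rw [← eLpNorm_congr_ae (coeFn_mollifyL2 hk' hkc' w),
        ← ENNReal.ofReal_toReal (Lp.eLpNorm_ne_top _), ← Lp.norm_def]
      exact ENNReal.ofReal_le_ofReal ((norm_mollifyL2_le _ _).trans
        (mul_le_mul (hK j) hwz (norm_nonneg _) hK0))
    · simp only [fderiv_mollify_apply hk hkc]
      exact sum_mollify_fderiv_eq_zero hk hkc (fun g hg => inner_lerayP_of_mem z hg) x
  have h3 : ‖w‖ ^ 2 = inner ℝ z (w - mollifyL2 k w) + inner ℝ z (mollifyL2 k w) := by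
    rw [← inner_add_right, sub_add_cancel]
    exact norm_lerayP_sq z
  have h4 : inner ℝ z (w - mollifyL2 k w) ≤ ‖z‖ * (δ * (∑ j, ‖D j t₂‖ + ∑ j, ‖D j t₁‖)) :=
    (real_inner_le_norm _ _).trans (mul_le_mul_of_nonneg_left h1 (norm_nonneg _))
  rw [h3]
  refine (add_le_add h4 ((le_abs_self _).trans h2)).trans (le_of_eq ?_)
  ring

/-- The time translation estimate in squared form, at an arbitrary mollification scale `δ`. -/
theorem lintegral_lerayP_increment_sq_le (hs : IsWeakSolutionWithGradient ε u₀ p₀ u p D)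
    (hε : 0 < ε) {E : ℝ} (hE : 1 / 2 * ‖u₀‖ ^ 2 + ε / 2 * ‖p₀‖ ^ 2 ≤ E) {T h : ℝ} (hT : 0 < T)
    (hh : h ∈ Ioo (0 : ℝ) 1)
    {k : R3 → ℝ} (hk : ContDiff ℝ ∞ k) (hkc : HasCompactSupport k) (hk0 : ∀ y, 0 ≤ k y)
    (hk1 : ∫ y, k y = 1) {δ K L : ℝ} (hδ0 : 0 ≤ δ) (hδ : ∀ y, δ < ‖y‖ → k y = 0)
    (hK : ∀ j, ∫ y, ‖fderiv ℝ k y (unitVec j)‖ ≤ K)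
    (hL : (∫ y, ‖k y‖ ^ (2 : ℝ)) ^ (1 / 2 : ℝ) ≤ L) {U J : ℝ} (hU : U = Real.sqrt (2 * E))
    (hJ : J = 3 / 2 * (T + 1) + E / 2) :
    ∫⁻ t in Icc 0 T, ‖lerayP (u (t + h)) - lerayP (u t)‖ₑ ^ (2 : ℝ)
      ≤ ENNReal.ofReal (4 * U * J * δ + 2 * U * (K + 3 / 2 * U * L) * J * h) := by
  have hU0 : 0 ≤ U := hU ▸ Real.sqrt_nonneg _
  have hK0 : 0 ≤ K := (integral_nonneg fun y => norm_nonneg _).trans (hK 0)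
  have hL0 : 0 ≤ L := le_trans (by positivity) hL
  set s : ℝ → ℝ := (Ioi (0 : ℝ)).indicator fun t => ∑ j, ‖D j t‖
  have hsl : LocallyIntegrable s volume :=
    locallyIntegrable_indicator fun T hT => hs.integrableOn_sum_norm_gradient hT
  have hs0 : ∀ t, 0 ≤ s t := fun t => indicator_nonneg (fun t _ => by positivity) t
  have hspos : ∀ t, 0 < t → s t = ∑ j, ‖D j t‖ := fun t ht => indicator_of_mem (mem_Ioi.2 ht) _
  have hi : ∀ x y, IntervalIntegrable s volume x y := fun x y =>
    intervalIntegrable_iff.2 ((hsl.integrableOn_isCompact isCompact_uIcc).mono_set uIoc_subset_uIcc)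
  have hsJ : ∫ r in (0 : ℝ)..(T + 1), s r ≤ J := by
    rw [hJ]
    refine le_of_eq_of_le ?_ (hs.integral_sum_norm_gradient_le hε hE (by linarith : 0 < T + 1))
    rw [intervalIntegral.integral_of_le (by linarith), intervalIntegral.integral_of_le (by linarith)]
    exact setIntegral_congr_fun measurableSet_Ioc fun t ht => hspos t ht.1
  have hul : LocallyIntegrable ((Ioi (0 : ℝ)).indicator u) volume :=
    locallyIntegrable_indicator fun T hT => hs.integrableOn_velocity hT
  have hUae := (ae_restrict_iff' measurableSet_Ioi).1 (hs.ae_norm_velocity_le hε hE)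
  have hgood : ∀ᵐ t, t ∈ Ioi (0 : ℝ) → IsRegularTime ((Ioi (0 : ℝ)).indicator u) t ∧
      (∀ j, IsWeakPartial j (u t) (D j t)) ∧ ‖u t‖ ≤ U := by
    filter_upwards [ae_isRegularTime hul, (ae_restrict_iff' measurableSet_Ioi).1 hs.isWeakPartial,
      hUae] with t h1 h2 h3 ht
    exact ⟨h1, h2 ht, hU ▸ h3 ht⟩
  -- Null sets are translation invariant, so t + h is a good time for almost every t as well.
  have hgood' := (measurePreserving_add_right (volume : Measure ℝ) h).quasiMeasurePreserving.ae hgood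
  -- The pointwise bound with ‖z‖ ≤ 2U and ‖u‖ ≤ U inserted. On [0, T] the two shifts of s integrate
  -- to at most 2J, and the windows to at most hJ.
  set R : ℝ → ℝ := fun t => 2 * U * δ * (s (t + h) + s t)
    + 2 * U * (K + 3 / 2 * U * L) * ∫ r in t..(t + h), s r
  have hwin : Continuous fun t => ∫ r in t..(t + h), s r := by
    have hB : Continuous fun x => ∫ r in (0 : ℝ)..x, s r := intervalIntegral.continuous_primitive hi 0
    have e : ∀ t, ∫ r in t..(t + h), s r = (∫ r in (0 : ℝ)..(t + h), s r) - ∫ r in (0 : ℝ)..t, s r :=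
      fun t => (intervalIntegral.integral_interval_sub_left (hi _ _) (hi _ _)).symm
    simp only [e]
    exact (hB.comp (continuous_add_const h)).sub hB
  have hi1 : IntervalIntegrable (fun t => s (t + h)) volume 0 T := by
    simpa using (hi (0 + h) (T + h)).comp_add_right h
  have hRi : IntervalIntegrable R volume 0 T :=
    ((hi1.add (hi 0 T)).const_mul _).add ((hwin.intervalIntegrable 0 T).const_mul _)
  have hR0 : ∀ t, 0 ≤ R t := by
    intro t
    have h1 : 0 ≤ ∫ r in t..(t + h), s r :=
      intervalIntegral.integral_nonneg (by linarith [hh.1]) fun r _ => hs0 r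
    have h2 := hs0 t
    have h3 := hs0 (t + h)
    positivity
  have hpt : ∀ᵐ t, t ∈ Ioc 0 T →
      ‖lerayP (u (t + h)) - lerayP (u t)‖ₑ ^ (2 : ℝ) ≤ ENNReal.ofReal (R t) := by
    filter_upwards [hgood, hgood'] with t g1 g2 ht
    have hth : 0 < t + h := by linarith [ht.1, hh.1]
    obtain ⟨r1, d1, b1⟩ := g1 ht.1
    obtain ⟨r2, d2, b2⟩ := g2 hth
    have hle : t ≤ t + h := by linarith [hh.1]
    have key := hs.norm_lerayP_increment_sq_le hε ht.1 (by linarith [hh.1] : t < t + h) r1 r2 d1 d2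
      hk hkc hk0 hk1 hδ hK hL
    have hz : ‖u (t + h) - u t‖ ≤ 2 * U := (norm_sub_le _ _).trans (by linarith)
    have e1 : ∫ r in t..(t + h), ∑ j, ‖D j r‖ = ∫ r in t..(t + h), s r := by
      rw [intervalIntegral.integral_of_le hle, intervalIntegral.integral_of_le hle]
      exact setIntegral_congr_fun measurableSet_Ioc fun r hr => (hspos r (ht.1.trans hr.1)).symm
    have e2 : ∫ r in t..(t + h), ‖u r‖ * ∑ j, ‖D j r‖ ≤ U * ∫ r in t..(t + h), s r := by
      rw [← e1, ← intervalIntegral.integral_const_mul]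
      have hsub : Ioc t (t + h) ⊆ Ioc 0 (t + h) := Ioc_subset_Ioc_left ht.1.le
      rw [intervalIntegral.integral_of_le hle, intervalIntegral.integral_of_le hle]
      refine setIntegral_mono_on_ae ((hs.integrableOn_norm_mul_sum hth).mono_set hsub)
        (((hs.integrableOn_sum_norm_gradient hth).mono_set hsub).const_mul U) measurableSet_Ioc ?_
      filter_upwards [hUae] with r hr hr'
      exact mul_le_mul_of_nonneg_right (hU ▸ hr (ht.1.trans hr'.1)) (by positivity)
    rw [e1, ← hspos _ hth, ← hspos _ ht.1] at key
    have hw0 : 0 ≤ ∫ r in t..(t + h), s r := intervalIntegral.integral_nonneg hle fun r _ => hs0 r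
    have hst := hs0 t
    have hsth := hs0 (t + h)
    have hfin : ‖lerayP (u (t + h) - u t)‖ ^ 2 ≤ R t := by
      refine key.trans ?_
      have f1 : ‖u (t + h) - u t‖ * (δ * (s (t + h) + s t)) ≤ 2 * U * (δ * (s (t + h) + s t)) := by
        gcongr
      have f2 : (∫ r in t..(t + h), s r) * K
          + 3 / 2 * (∫ r in t..(t + h), ‖u r‖ * ∑ j, ‖D j r‖) * L
          ≤ (K + 3 / 2 * U * L) * ∫ r in t..(t + h), s r := by
        have := mul_le_mul_of_nonneg_right e2 hL0
        linarith
      have f3 := mul_le_mul f2 hz (norm_nonneg _) (by positivity)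
      refine (add_le_add f1 f3).trans (le_of_eq ?_)
      simp only [R]
      ring
    rw [← map_sub, ← ofReal_norm, ENNReal.ofReal_rpow_of_nonneg (norm_nonneg _) (by norm_num)]
    exact ENNReal.ofReal_le_ofReal (by exact_mod_cast hfin)
  rw [Measure.restrict_congr_set Ioc_ae_eq_Icc.symm]
  calc ∫⁻ t in Ioc 0 T, ‖lerayP (u (t + h)) - lerayP (u t)‖ₑ ^ (2 : ℝ)
      ≤ ∫⁻ t in Ioc 0 T, ENNReal.ofReal (R t) :=
        lintegral_mono_ae ((ae_restrict_iff' measurableSet_Ioc).2 hpt)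
    _ = ENNReal.ofReal (∫ t in (0 : ℝ)..T, R t) := by
        rw [intervalIntegral.integral_of_le hT.le]
        exact (ofReal_integral_eq_lintegral_ofReal hRi.1 (Eventually.of_forall hR0)).symm
    _ ≤ _ := by
        refine ENNReal.ofReal_le_ofReal ?_
        simp only [R]
        rw [intervalIntegral.integral_add ((hi1.add (hi 0 T)).const_mul _)
          ((hwin.intervalIntegrable 0 T).const_mul _), intervalIntegral.integral_const_mul,
          intervalIntegral.integral_const_mul, intervalIntegral.integral_add hi1 (hi 0 T)]
        have g1 := integral_shift_le hsl hs0 hT ⟨hh.1.le, hh.2.le⟩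
        have g2 : ∫ t in (0 : ℝ)..T, s t ≤ ∫ r in (0 : ℝ)..(T + 1), s r := by
          simpa using integral_shift_le hsl hs0 hT ⟨le_rfl, zero_le_one⟩
        have g3 := (integral_window_le hsl hs0 hh).trans
          (mul_le_mul_of_nonneg_left hsJ hh.1.le)
        have g4 : (∫ t in (0 : ℝ)..T, s (t + h)) + ∫ t in (0 : ℝ)..T, s t ≤ 2 * J := by linarith
        refine (add_le_add (mul_le_mul_of_nonneg_left g4 (by positivity))
          (mul_le_mul_of_nonneg_left g3 (by positivity))).trans (le_of_eq ?_)
        ring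

end IsWeakSolutionWithGradient

/-! ### Uniform initial energy and choice of the mollification scale -/

theorem InitialDataCondition.exists_energy_bound {ε : ℕ → ℝ} (hε : ∀ n, 0 < ε n)
    {u₀ : ℕ → VectorL2} {p₀ : ℕ → ScalarL2} (h : InitialDataCondition ε u₀ p₀) :
    ∃ E : ℝ, ∀ n, 1 / 2 * ‖u₀ n‖ ^ 2 + ε n / 2 * ‖p₀ n‖ ^ 2 ≤ E := by
  obtain ⟨⟨v₀, hv⟩, hp⟩ := h
  -- Convergent sequences are bounded; this is where the constant becomes independent of n.
  obtain ⟨a, ha⟩ := hv.norm.bddAbove_range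
  obtain ⟨b, hb⟩ := hp.norm.bddAbove_range
  refine ⟨1 / 2 * a ^ 2 + 1 / 2 * b ^ 2, fun n => ?_⟩
  have h1 : ‖u₀ n‖ ≤ a := ha ⟨n, rfl⟩
  have h2 : ‖Real.sqrt (ε n) • p₀ n‖ ≤ b := hb ⟨n, rfl⟩
  have h3 : ‖Real.sqrt (ε n) • p₀ n‖ ^ 2 = ε n * ‖p₀ n‖ ^ 2 := by
    rw [norm_smul, mul_pow, Real.norm_of_nonneg (Real.sqrt_nonneg _), Real.sq_sqrt (hε n).le]
  have h4 := pow_le_pow_left₀ (norm_nonneg _) h1 2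
  have h5 := pow_le_pow_left₀ (norm_nonneg _) h2 2
  linarith

end ArtificialCompressibility

theorem lemma5p5 (ε : ℕ → ℝ) (hε : ∀ n, 0 < ε n) (hε0 : Tendsto ε atTop (𝓝 0))
    (u₀ : ℕ → ArtificialCompressibility.VectorL2) (p₀ : ℕ → ArtificialCompressibility.ScalarL2)
    (hID : ArtificialCompressibility.InitialDataCondition ε u₀ p₀)
    (T : ℝ) (hT : 0 < T) :
    ∃ C : ℝ, ∀ (n : ℕ) (u : ℝ → ArtificialCompressibility.VectorL2)
      (p : ℝ → ArtificialCompressibility.ScalarL2),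
      ArtificialCompressibility.IsWeakSolution (ε n) (u₀ n) (p₀ n) u p →
      ∀ h ∈ Ioo (0 : ℝ) 1,
        eLpNorm (fun t => ArtificialCompressibility.lerayP (u (t + h))
            - ArtificialCompressibility.lerayP (u t)) 2 (volume.restrict (Icc 0 T))
          ≤ ENNReal.ofReal (C * h ^ (1 / 5 : ℝ)) := by
  obtain ⟨E, hE⟩ := hID.exists_energy_bound hε
  obtain ⟨C, hC, hmol⟩ := ArtificialCompressibility.exists_mollifier
  have hE0 : 0 ≤ E := le_trans (by have := hε 0; positivity) (hE 0)
  obtain ⟨U, hU⟩ : ∃ U, U = Real.sqrt (2 * E) := ⟨_, rfl⟩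
  obtain ⟨J, hJ⟩ : ∃ J, J = 3 / 2 * (T + 1) + E / 2 := ⟨_, rfl⟩
  have hU0 : 0 ≤ U := hU ▸ Real.sqrt_nonneg _
  have hJ0 : 0 ≤ J := by rw [hJ]; positivity
  refine ⟨Real.sqrt (4 * U * J + 2 * U * (C + 3 / 2 * U * C) * J), fun n u p hsol h hh => ?_⟩
  obtain ⟨D, hs⟩ := hsol
  have hh0 : 0 < h := hh.1
  -- The scale δ = h^(2/5) balances the mollification error δ against the nonlinear term hδ^(-3/2).
  obtain ⟨k, hk, hkc, hk0, hk1, hδ, hK, hL⟩ := hmol (h ^ (2 / 5 : ℝ)) (by positivity)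
  have key := hs.lintegral_lerayP_increment_sq_le (hε n) (hE n) hT hh hk hkc hk0 hk1 (by positivity)
    hδ hK hL hU hJ
  -- The viscous term hδ⁻¹ = h^(3/5) is of lower order, since h < 1.
  have e1 : (h ^ (2 / 5 : ℝ))⁻¹ * h ≤ h ^ (2 / 5 : ℝ) := by
    have : (h ^ (2 / 5 : ℝ))⁻¹ * h = h ^ (3 / 5 : ℝ) := by
      rw [← Real.rpow_neg hh0.le, ← Real.rpow_add_one hh0.ne']
      norm_num
    rw [this]
    exact Real.rpow_le_rpow_of_exponent_ge hh0 hh.2.le (by norm_num)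
  have e2 : (h ^ (2 / 5 : ℝ)) ^ (-(3 / 2) : ℝ) * h = h ^ (2 / 5 : ℝ) := by
    rw [← Real.rpow_mul hh0.le, ← Real.rpow_add_one hh0.ne']
    norm_num
  have e3 : 4 * U * J * h ^ (2 / 5 : ℝ) + 2 * U * (C * (h ^ (2 / 5 : ℝ))⁻¹
      + 3 / 2 * U * (C * (h ^ (2 / 5 : ℝ)) ^ (-(3 / 2) : ℝ))) * J * h
      ≤ (4 * U * J + 2 * U * (C + 3 / 2 * U * C) * J) * h ^ (2 / 5 : ℝ) := by
    have h1 := mul_le_mul_of_nonneg_left e1 (by positivity : 0 ≤ 2 * U * C * J)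
    have h2 := congrArg (2 * U * (3 / 2 * U * C) * J * ·) e2
    linarith
  rw [eLpNorm_eq_lintegral_rpow_enorm_toReal (by simp) (by simp)]
  simp only [ENNReal.toReal_ofNat]
  refine (ENNReal.rpow_le_rpow (key.trans (ENNReal.ofReal_le_ofReal e3)) (by norm_num)).trans ?_
  rw [ENNReal.ofReal_rpow_of_nonneg (by positivity) (by norm_num),
    Real.mul_rpow (by positivity) (by positivity), ← Real.rpow_mul hh0.le, ← Real.sqrt_eq_rpow]
  norm_num
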